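/- Let $\mathbb{O}$ be the algebra of octonions with its standard orthonormal real basis $e_0=1,e_1,\dots,e_7$, and let $\mathcal{H}_2(\mathbb{O})$ be the real vector space of octonionic Hermitian matrices $X=\begin{pmatrix} a& q\\ \bar q& b\end{pmatrix}$, $a,b\in\mathbb{R}$, $q\in\mathbb{O}$. Put $\det X=ab-|q|^2$, and call $X$ positive definite if $\mathrm{Re}(\xi^*X\xi)>0$ for all $\xi\in\mathbb{O}^2\setminus\{0\}$. Let $\mathfrak{sl}_2(\mathbb{O})$ be the Lie subalgebra of $\mathfrak{gl}_{16}(\mathbb{R})$ generated by the operators $\xi\mapsto A\xi$ on $\mathbb{O}^2=\mathbb{R}^{16}$ with $A$ a traceless octonionic $2\times 2$ matrix, let $SL_2(\mathbb{O})\subset GL_{16}(\mathbb{R})$ be the connected Lie subgroup with this Lie algebra, and let $GL_2(\mathbb{O})=\mathbb{R}^*\cdot SL_2(\mathbb{O})$. Let $\rho$ be the representation of $GL_2(\mathbb{O})$ on $\mathcal{H}_2(\mathbb{O})$ for which $\rho(\lambda)X=\lambda^{-2}X$ for $\lambda\in\mathbb{R}^*$ and whose differential sends the operator of a traceless matrix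 $A$ to $X\mapsto -A^*X-XA$. A $GL_2(\mathbb{O})$-manifold is a (Hausdorff) 16-dimensional manifold with an atlas of charts in $\mathbb{O}^2$ whose transition maps are, locally, compositions of a transformation from $GL_2(\mathbb{O})$ and a translation. On such a manifold $M$ let $\underline{\mathcal{H}}_2(M)$ be the vector bundle with fibre $\mathcal{H}_2(\mathbb{O})$ that is trivial over each chart $\psi_\alpha$ and glued over overlaps by $(x,X)\mapsto (x,\rho(d_x(\psi_\beta\circ\psi_\alpha^{-1}))X)$; a section is positive if in every chart its value at every point is positive definite. For a real $C^2$ function $\varphi$ on $M$ the octonionic Hessian $\mathrm{Hess}_{\mathbb{O}}(\varphi)$ is the section of $\underline{\mathcal{H}}_2(M)$ given in a chart with coordinates $q_i=\sum_a x_i^a e_a$, $i=1,2$, by the matrix $\left(\frac{\partial^2\varphi}{\partial\bar q_i\,\partial q_j}\right)_{i,j=1,2}$, where $\frac{\partial F}{\partial \bar q_i}=\sum_{a} e_a\frac{\partial F}{\partial x_i^a}$ and $\frac{\partial F}{\partial q_j}=\sum_{a}\frac{\partial F}{\partial x_j^a}\bar e_a$. Theorem. Let $M$ be a compact connected $GL_2(\mathbb{O})$-manifold,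 let $G_0$ be a continuous positive section of $\underline{\mathcal{H}}_2(M)$, and let $f\colon M\to\mathbb{R}$ be a continuous function. Let $\varphi_1,\varphi_2\colon M\to\mathbb{R}$ be $C^2$ functions such that, for $k=1,2$, $$\det(G_0+\mathrm{Hess}_{\mathbb{O}}(\varphi_k))=e^f\det(G_0)$$ in every chart of the atlas. Then $\varphi_1-\varphi_2$ is constant. -/

import Mathlib

open scoped Manifold Matrix

noncomputable section

/-! ### Octonions -/

/-- The octonions as a Euclidean space, with orthonormal basis `e 0 = 1, e 1, …, e 7`. -/
abbrev Octonion : Type := EuclideanSpace ℝ (Fin 8)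

namespace Octonion

/-- The basis octonions `e 0, …, e 7`. -/
def e (a : Fin 8) : Octonion := EuclideanSpace.single a 1

/-- The real part. -/
def re (x : Octonion) : ℝ := x 0

/-- The real number `r` as an octonion. -/
def ofReal (r : ℝ) : Octonion := r • e 0

/-- The octonionic product: the bilinear product with unit `e 0`, with `e i * e i = - e 0` for
`i ≠ 0`, and `e i * e j = e k = - e j * e i` for each of the seven oriented lines
`(i, j, k) = (1,2,4), (2,3,5), (3,4,6), (4,5,7), (5,6,1), (6,7,2), (7,1,3)` of the Fano plane and
their cyclic permutations. -/
instance instMul : Mul Octonion where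
  mul x y :=
    !₂[x 0 * y 0 - x 1 * y 1 - x 2 * y 2 - x 3 * y 3
        - x 4 * y 4 - x 5 * y 5 - x 6 * y 6 - x 7 * y 7,
      x 0 * y 1 + x 1 * y 0 + (x 2 * y 4 - x 4 * y 2)
        + (x 3 * y 7 - x 7 * y 3) + (x 5 * y 6 - x 6 * y 5),
      x 0 * y 2 + x 2 * y 0 + (x 3 * y 5 - x 5 * y 3)
        + (x 4 * y 1 - x 1 * y 4) + (x 6 * y 7 - x 7 * y 6),
      x 0 * y 3 + x 3 * y 0 + (x 4 * y 6 - x 6 * y 4)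
        + (x 5 * y 2 - x 2 * y 5) + (x 7 * y 1 - x 1 * y 7),
      x 0 * y 4 + x 4 * y 0 + (x 1 * y 2 - x 2 * y 1)
        + (x 5 * y 7 - x 7 * y 5) + (x 6 * y 3 - x 3 * y 6),
      x 0 * y 5 + x 5 * y 0 + (x 2 * y 3 - x 3 * y 2)
        + (x 6 * y 1 - x 1 * y 6) + (x 7 * y 4 - x 4 * y 7),
      x 0 * y 6 + x 6 * y 0 + (x 1 * y 5 - x 5 * y 1)
        + (x 3 * y 4 - x 4 * y 3) + (x 7 * y 2 - x 2 * y 7),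
      x 0 * y 7 + x 7 * y 0 + (x 1 * y 3 - x 3 * y 1)
        + (x 2 * y 6 - x 6 * y 2) + (x 4 * y 5 - x 5 * y 4)]

theorem mul_def (x y : Octonion) : x * y =
    !₂[x 0 * y 0 - x 1 * y 1 - x 2 * y 2 - x 3 * y 3
        - x 4 * y 4 - x 5 * y 5 - x 6 * y 6 - x 7 * y 7,
      x 0 * y 1 + x 1 * y 0 + (x 2 * y 4 - x 4 * y 2)
        + (x 3 * y 7 - x 7 * y 3) + (x 5 * y 6 - x 6 * y 5),
      x 0 * y 2 + x 2 * y 0 + (x 3 * y 5 - x 5 * y 3)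
        + (x 4 * y 1 - x 1 * y 4) + (x 6 * y 7 - x 7 * y 6),
      x 0 * y 3 + x 3 * y 0 + (x 4 * y 6 - x 6 * y 4)
        + (x 5 * y 2 - x 2 * y 5) + (x 7 * y 1 - x 1 * y 7),
      x 0 * y 4 + x 4 * y 0 + (x 1 * y 2 - x 2 * y 1)
        + (x 5 * y 7 - x 7 * y 5) + (x 6 * y 3 - x 3 * y 6),
      x 0 * y 5 + x 5 * y 0 + (x 2 * y 3 - x 3 * y 2)
        + (x 6 * y 1 - x 1 * y 6) + (x 7 * y 4 - x 4 * y 7),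
      x 0 * y 6 + x 6 * y 0 + (x 1 * y 5 - x 5 * y 1)
        + (x 3 * y 4 - x 4 * y 3) + (x 7 * y 2 - x 2 * y 7),
      x 0 * y 7 + x 7 * y 0 + (x 1 * y 3 - x 3 * y 1)
        + (x 2 * y 6 - x 6 * y 2) + (x 4 * y 5 - x 5 * y 4)] := rfl

/-- Octonionic conjugation. -/
instance instStar : Star Octonion where
  star x := !₂[x 0, -x 1, -x 2, -x 3, -x 4, -x 5, -x 6, -x 7]

theorem star_def (x : Octonion) :
    star x = !₂[x 0, -x 1, -x 2, -x 3, -x 4, -x 5, -x 6, -x 7] := rfl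

instance instNonUnitalNonAssocRing : NonUnitalNonAssocRing Octonion :=
  { (inferInstance : AddCommGroup Octonion), instMul with
    left_distrib := fun x y z => by
      ext i; fin_cases i <;> simp [mul_def] <;> ring
    right_distrib := fun x y z => by
      ext i; fin_cases i <;> simp [mul_def] <;> ring
    zero_mul := fun x => by
      ext i; fin_cases i <;> simp [mul_def]
    mul_zero := fun x => by
      ext i; fin_cases i <;> simp [mul_def] }

end Octonion

/-! ### Octonionic linear algebra -/

/-- The space `𝕆² = ℝ¹⁶` of octonionic 2-columns. -/
abbrev OctPlane : Type := Fin 2 → Octonion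

/-- Octonionic `2 × 2` matrices. -/
abbrev OctMatrix : Type := Matrix (Fin 2) (Fin 2) Octonion

/-- The real vector space of octonionic Hermitian `2 × 2` matrices `[[a, q], [conj q, b]]`, in the
coordinates `(a, b, q)`. -/
abbrev OctHerm : Type := ℝ × ℝ × Octonion

/-- The Hermitian matrix with coordinates `(a, b, q)`. -/
def OctHerm.toMatrix (X : OctHerm) : OctMatrix :=
  !![Octonion.ofReal X.1, X.2.2; star X.2.2, Octonion.ofReal X.2.1]

/-- The real quadratic form `Re (ξ* X ξ)` of an octonionic matrix. -/
def octQuad (X : OctMatrix) (ξ : OctPlane) : ℝ := (star ξ ⬝ᵥ (X *ᵥ ξ)).re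

/-- Positive definiteness of an octonionic Hermitian matrix. -/
def OctHerm.PosDef (X : OctHerm) : Prop := ∀ ξ : OctPlane, ξ ≠ 0 → 0 < octQuad X.toMatrix ξ

/-- The determinant `a b - |q|²` of the octonionic Hermitian matrix `[[a, q], [conj q, b]]`. -/
def octDet (X : OctMatrix) : ℝ := (X 0 0).re * (X 1 1).re - ‖X 0 1‖ ^ 2

/-! ### The groups `SL₂(𝕆)`, `GL₂(𝕆)` and the action on Hermitian matrices -/

attribute [local instance] LieRing.ofAssociativeRing LieAlgebra.ofAssociativeAlgebra

/-- `𝔰𝔩₂(𝕆)`: the Lie subalgebra of `𝔤𝔩₁₆(ℝ)` generated by the operators `ξ ↦ A ξ` of all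
traceless octonionic matrices `A`. -/
def sl2Oct : LieSubalgebra ℝ (OctPlane →L[ℝ] OctPlane) :=
  LieSubalgebra.lieSpan ℝ _
    {Z | ∃ A : OctMatrix, A 0 0 + A 1 1 = 0 ∧ ∀ ξ, Z ξ = A *ᵥ ξ}

/-- `SL₂(𝕆)`: the connected Lie subgroup of `GL₁₆(ℝ)` with Lie algebra `𝔰𝔩₂(𝕆)`, that is, the
subgroup generated by the exponentials of elements of `𝔰𝔩₂(𝕆)`. -/
def SL2Oct : Subgroup (OctPlane →L[ℝ] OctPlane)ˣ :=
  Subgroup.closure {g | ∃ Z ∈ sl2Oct, (g : OctPlane →L[ℝ] OctPlane) = NormedSpace.exp Z}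

/-- `GL₂(𝕆) = ℝˣ · SL₂(𝕆)`: the group generated by `SL₂(𝕆)` and the homotheties. -/
def GL2Oct : Subgroup (OctPlane →L[ℝ] OctPlane)ˣ :=
  SL2Oct ⊔ Subgroup.closure {g | ∃ c : ℝ, c ≠ 0 ∧ (g : OctPlane →L[ℝ] OctPlane) = c • 1}

/-- The graph of the Lie algebra representation of `𝔰𝔩₂(𝕆)` on Hermitian matrices that is
determined by letting a traceless octonionic matrix `A` act by `X ↦ -A* X - X A`. -/
def sl2OctActGraph :
    LieSubalgebra ℝ ((OctPlane →L[ℝ] OctPlane) × (OctHerm →L[ℝ] OctHerm)) :=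
  LieSubalgebra.lieSpan ℝ _
    {Z | ∃ A : OctMatrix, A 0 0 + A 1 1 = 0 ∧ (∀ ξ, Z.1 ξ = A *ᵥ ξ) ∧
      ∀ X, (Z.2 X).toMatrix = -(Aᴴ * X.toMatrix) - X.toMatrix * A}

/-- The graph of the representation `ρ` of `GL₂(𝕆)` on Hermitian matrices: on `SL₂(𝕆)` it
integrates the representation of `𝔰𝔩₂(𝕆)`, and a homothety `c` acts by `c⁻²`. Membership of
`(g, R)` means `g ∈ GL₂(𝕆)` and `ρ(g) = R`. -/
def octRhoGraph : Subgroup ((OctPlane →L[ℝ] OctPlane)ˣ × (OctHerm →L[ℝ] OctHerm)ˣ) :=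
  Subgroup.closure
    ({p | ∃ Z ∈ sl2OctActGraph, (p.1 : OctPlane →L[ℝ] OctPlane) = NormedSpace.exp Z.1 ∧
        (p.2 : OctHerm →L[ℝ] OctHerm) = NormedSpace.exp Z.2} ∪
      {p | ∃ c : ℝ, c ≠ 0 ∧ (p.1 : OctPlane →L[ℝ] OctPlane) = c • 1 ∧
        (p.2 : OctHerm →L[ℝ] OctHerm) = (c ^ 2)⁻¹ • 1})

/-! ### The octonionic Hessian -/

/-- The vector of `𝕆²` with `i`-th entry `e a` and other entry zero. -/
def octBasis (i : Fin 2) (a : Fin 8) : OctPlane := Pi.single i (Octonion.e a)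

/-- `∂F/∂q̄ᵢ = ∑ₐ eₐ ∂F/∂xᵢᵃ`. -/
def octDBar (i : Fin 2) (F : OctPlane → Octonion) (p : OctPlane) : Octonion :=
  ∑ a, Octonion.e a * fderiv ℝ F p (octBasis i a)

/-- `∂F/∂qⱼ = ∑ₐ ∂F/∂xⱼᵃ ēₐ`. -/
def octD (j : Fin 2) (F : OctPlane → Octonion) (p : OctPlane) : Octonion :=
  ∑ a, fderiv ℝ F p (octBasis j a) * star (Octonion.e a)

/-- The octonionic Hessian `(∂²u/∂q̄ᵢ∂qⱼ)` of a real-valued function. -/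
def octHess (u : OctPlane → ℝ) (p : OctPlane) : OctMatrix :=
  Matrix.of fun i j => octDBar i (octD j fun q => Octonion.ofReal (u q)) p

/-! ### `G`-affine manifolds and sections of the bundle of Hermitian matrices -/

/-- The pseudogroup of maps between open subsets of `𝕆²` that are locally the composition of a
transformation from `G` and a translation. -/
def affineGroupoid (G : Subgroup (OctPlane →L[ℝ] OctPlane)ˣ) : StructureGroupoid OctPlane :=
  Pregroupoid.groupoid
    { property := fun f u => ∀ x ∈ u, ∃ g ∈ G, ∃ c : OctPlane,
        ∀ᶠ y in nhds x, f y = (g : OctPlane →L[ℝ] OctPlane) y + c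
      comp := by
        intro f f' u v hf hf' _ _ _ x hx
        obtain ⟨g, hg, c, h⟩ := hf x hx.1
        obtain ⟨g', hg', c', h'⟩ := hf' (f x) hx.2
        refine ⟨g' * g, mul_mem hg' hg, (g' : OctPlane →L[ℝ] OctPlane) c + c', ?_⟩
        have hcont : Filter.Tendsto f (nhds x) (nhds (f x)) := by
          have h0 : f x = (g : OctPlane →L[ℝ] OctPlane) x + c := h.self_of_nhds
          rw [h0]
          refine Filter.Tendsto.congr' (Filter.EventuallyEq.symm h) ?_
          exact ((g : OctPlane →L[ℝ] OctPlane).continuous.add continuous_const).tendsto x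
        filter_upwards [h, hcont.eventually h'] with y hy hy'
        rw [Function.comp_apply, hy', hy, map_add, add_assoc]
        rfl
      id_mem := by
        intro x _
        exact ⟨1, one_mem G, 0, Filter.Eventually.of_forall fun y => by simp⟩
      locality := by
        intro f u _ h x hx
        obtain ⟨v, _, hxv, hv⟩ := h x hx
        exact hv x ⟨hx, hxv⟩
      congr := by
        intro f g u hu hfg hf x hx
        obtain ⟨a, ha, c, h⟩ := hf x hx
        refine ⟨a, ha, c, ?_⟩
        filter_upwards [h, hu.mem_nhds hx] with y hy hyu
        rw [hfg y hyu, hy] }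

/-- A section of the vector bundle on a `GL₂(𝕆)`-manifold whose fibre is the space of octonionic
Hermitian matrices and whose transition maps are given by `ρ`, described by its expressions in
the charts of the atlas: the expressions in two charts are related by `ρ` of the differential of
the change of coordinates. Values of `inChart e x` for `e` outside the atlas or `x` outside the
domain of `e` carry no information. -/
structure OctHermSection (M : Type*) [TopologicalSpace M] [ChartedSpace OctPlane M] where
  /-- The expression of the section in a chart. -/
  inChart : OpenPartialHomeomorph M OctPlane → M → OctHerm
  /-- Change of coordinates. -/
  transition : ∀ e ∈ atlas OctPlane M, ∀ e' ∈ atlas OctPlane M, ∀ x ∈ e.source ∩ e'.source,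
    ∃ p ∈ octRhoGraph, (p.1 : OctPlane →L[ℝ] OctPlane) = fderiv ℝ (e' ∘ e.symm) (e x) ∧
      inChart e' x = (p.2 : OctHerm →L[ℝ] OctHerm) (inChart e x)

namespace OctHermSection

variable {M : Type*} [TopologicalSpace M] [ChartedSpace OctPlane M]

/-- Continuity of a section. -/
def IsContinuous (G : OctHermSection M) : Prop :=
  ∀ e ∈ atlas OctPlane M, ContinuousOn (G.inChart e) e.source

/-- Positivity of a section: it is positive definite at every point, in every chart. -/
def IsPositive (G : OctHermSection M) : Prop :=
  ∀ e ∈ atlas OctPlane M, ∀ x ∈ e.source, (G.inChart e x).PosDef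

/-- `φ` satisfies `det (G₀ + Hess φ) = exp f * det G₀`, an equality of `1/4`-densities, that is,
the equality holds in every chart. -/
def SolvesMongeAmpere (G : OctHermSection M) (f φ : M → ℝ) : Prop :=
  ∀ e ∈ atlas OctPlane M, ∀ x ∈ e.source,
    octDet ((G.inChart e x).toMatrix + octHess (φ ∘ e.symm) (e x))
      = Real.exp (f x) * octDet (G.inChart e x).toMatrix

end OctHermSection

end

/-!
On a chart write `H k = G₀ + Hess φₖ`. The difference of the two equations is linear in
`u = φ₁ - φ₂`: the determinant of `2 × 2` Hermitian matrices is a quadratic form, so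
`0 = det (H 1) - det (H 2)` is the polarized determinant of `H 1 + H 2` and `Hess u`
(`OctHerm.det_sub_det`). If `H 1 + H 2` is positive definite, this is an elliptic second order
equation for `u` without lower order terms (`sum_octEllipticDir`), and Hopf's strong maximum
principle (`eventually_eq_of_sum_fderiv_fderiv_nonneg`) shows that the set where `u` attains its
maximum is open. It is closed and nonempty, and `M` is connected, so `u` is constant.

Both `H k` are positive definite (`OctHermSection.SolvesMongeAmpere.addHess_fst_pos`): this holds at
a minimum of `φₖ`, and it persists along `M` because `det (H k)` never vanishes. The argument
compares different charts and needs that `Hess φ` transforms by `ρ` and that `ρ` preserves the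
positive cone. Both follow from one fact (`octSymProd_comp_of_mem`): the map that sends a real
functional on `𝕆²`, represented by a vector `v`, to the Hermitian matrix `v v*` is equivariant.
Indeed second derivatives are combinations of symmetric products of functionals, and the matrices
`v v*` span the positive cone. Infinitesimally the equivariance is the identity
`(A* v) v* + v (A* v)* = A* (v v*) + (v v*) A` for traceless `A` (`octSymProd_comp_generator`),
which holds because the associator is alternating. It passes to the generated Lie algebra, to
exponentials by differentiation, and to the generated group.
-/

noncomputable section

/-! ### Second derivatives -/

section SecondDerivatives

open Filter Topology

/-- The second derivative is nonpositive at a local maximum. If it were positive, the point would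
also be a local minimum, the function would be locally constant, and the derivative would vanish. -/
theorem nonpos_of_isLocalMax_of_hasDerivAt {f f' : ℝ → ℝ} {c : ℝ} (hmax : IsLocalMax f 0)
    (hf : ∀ᶠ t in 𝓝 0, HasDerivAt f (f' t) t) (hf' : HasDerivAt f' c 0) : c ≤ 0 := by
  by_contra! hc
  have h1 : deriv f =ᶠ[𝓝 0] f' := hf.mono fun t ht => ht.deriv
  have h2 : deriv (deriv f) 0 = c := by rw [h1.deriv_eq, hf'.deriv]
  have hmin : IsLocalMin f 0 := isLocalMin_of_deriv_deriv_pos (by rw [h2]; exact hc)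
    hmax.deriv_eq_zero hf.self_of_nhds.continuousAt
  have hconst : f =ᶠ[𝓝 0] fun _ => f 0 := by
    filter_upwards [hmax, hmin] with t h h' using le_antisymm h h'
  have h3 : deriv f =ᶠ[𝓝 0] fun _ => 0 := by
    filter_upwards [hconst.eventually_nhds] with t ht
    rw [Filter.EventuallyEq.deriv_eq ht, deriv_const]
  rw [h3.deriv_eq, deriv_const] at h2
  exact hc.ne h2

/-- The first and second derivatives along a line, in terms of `fderiv`. -/
theorem ContDiffAt.hasDerivAt_line {E : Type*} [NormedAddCommGroup E] [NormedSpace ℝ E]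
    {w : E → ℝ} {p : E} (hw : ContDiffAt ℝ 2 w p) (ξ : E) :
    (∀ᶠ t : ℝ in 𝓝 0, HasDerivAt (fun t : ℝ => w (p + t • ξ)) (fderiv ℝ w (p + t • ξ) ξ) t) ∧
      HasDerivAt (fun t : ℝ => fderiv ℝ w (p + t • ξ) ξ) (fderiv ℝ (fderiv ℝ w) p ξ ξ) 0 := by
  have hline : ∀ t : ℝ, HasDerivAt (fun t : ℝ => p + t • ξ) ξ t := fun t => by
    simpa using ((hasDerivAt_id t).smul_const ξ).const_add p
  have h0 : p + (0 : ℝ) • ξ = p := by simp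
  constructor
  · have ht : Tendsto (fun t : ℝ => p + t • ξ) (𝓝 0) (𝓝 p) := by
      have := (hline 0).continuousAt.tendsto
      rwa [h0] at this
    have hd : ∀ᶠ x in 𝓝 p, DifferentiableAt ℝ w x :=
      (hw.eventually (by simp)).mono fun x hx => hx.differentiableAt (by simp)
    filter_upwards [ht.eventually hd] with t h
    exact h.hasFDerivAt.comp_hasDerivAt t (hline t)
  · have hd : HasFDerivAt (fderiv ℝ w) (fderiv ℝ (fderiv ℝ w) p) (p + (0 : ℝ) • ξ) := by
      rw [h0]
      exact ((hw.fderiv_right (m := 1) one_add_one_eq_two.le).differentiableAt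
        one_ne_zero).hasFDerivAt
    have h1 : HasDerivAt (fun t : ℝ => fderiv ℝ w (p + t • ξ)) (fderiv ℝ (fderiv ℝ w) p ξ) 0 :=
      hd.comp_hasDerivAt (0 : ℝ) (hline 0)
    exact (ContinuousLinearMap.apply ℝ ℝ ξ).hasFDerivAt.comp_hasDerivAt (0 : ℝ) h1

/-- The second derivative test for `w + φ` along a line on which `φ` is a quartic polynomial; the
barrier of the strong maximum principle has this form. -/
theorem ContDiffAt.fderiv_fderiv_add_nonpos {E : Type*} [NormedAddCommGroup E] [NormedSpace ℝ E]
    {w φ : E → ℝ} {p ξ : E} (hw : ContDiffAt ℝ 2 w p) {c₀ c₁ c₂ c₃ c₄ : ℝ}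
    (hφ : ∀ t : ℝ, φ (p + t • ξ) = c₀ + c₁ * t + c₂ * t ^ 2 + c₃ * t ^ 3 + c₄ * t ^ 4)
    (hmax : IsLocalMax (fun x => w x + φ x) p) :
    fderiv ℝ (fderiv ℝ w) p ξ ξ + 2 * c₂ ≤ 0 := by
  obtain ⟨h1, h2⟩ := hw.hasDerivAt_line ξ
  have hp1 : ∀ t : ℝ, HasDerivAt (fun t : ℝ => φ (p + t • ξ))
      (c₁ + 2 * c₂ * t + 3 * c₃ * t ^ 2 + 4 * c₄ * t ^ 3) t := fun t => by
    simp_rw [hφ]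
    have h := ((((hasDerivAt_id t).const_mul c₁).const_add c₀).add
      ((hasDerivAt_pow 2 t).const_mul c₂)).add ((hasDerivAt_pow 3 t).const_mul c₃)
    refine (h.add ((hasDerivAt_pow 4 t).const_mul c₄)).congr_deriv ?_
    push_cast
    ring
  have hp2 : HasDerivAt (fun t : ℝ => c₁ + 2 * c₂ * t + 3 * c₃ * t ^ 2 + 4 * c₄ * t ^ 3)
      (2 * c₂) 0 := by
    have h := (((hasDerivAt_id (0 : ℝ)).const_mul (2 * c₂)).const_add c₁).add
      ((hasDerivAt_pow 2 (0 : ℝ)).const_mul (3 * c₃))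
    refine (h.add ((hasDerivAt_pow 3 (0 : ℝ)).const_mul (4 * c₄))).congr_deriv ?_
    simp
  refine nonpos_of_isLocalMax_of_hasDerivAt (f := fun t : ℝ => w (p + t • ξ) + φ (p + t • ξ))
    ?_ (h1.mono fun t ht => ht.add (hp1 t)) (h2.add hp2)
  have hc : ContinuousAt (fun t : ℝ => p + t • ξ) 0 := by fun_prop
  have h0 : p + (0 : ℝ) • ξ = p := by simp
  have ht : Tendsto (fun t : ℝ => p + t • ξ) (𝓝 0) (𝓝 p) := by
    have := hc.tendsto
    rwa [h0] at this
  filter_upwards [ht.eventually hmax] with t h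
  simpa [h0] using h

theorem ContDiffAt.fderiv_fderiv_symm {E : Type*} [NormedAddCommGroup E] [NormedSpace ℝ E]
    {u : E → ℝ} {p : E} (hu : ContDiffAt ℝ 2 u p) (v w : E) :
    fderiv ℝ (fderiv ℝ u) p v w = fderiv ℝ (fderiv ℝ u) p w v :=
  hu.isSymmSndFDerivAt (by simp) v w

theorem ContDiffAt.fderiv_fderiv_sub {E : Type*} [NormedAddCommGroup E] [NormedSpace ℝ E]
    {u v : E → ℝ} {p : E} (hu : ContDiffAt ℝ 2 u p) (hv : ContDiffAt ℝ 2 v p) :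
    fderiv ℝ (fderiv ℝ fun x => u x - v x) p =
      fderiv ℝ (fderiv ℝ u) p - fderiv ℝ (fderiv ℝ v) p := by
  have hd : ∀ {f : E → ℝ}, ContDiffAt ℝ 2 f p → ∀ᶠ x in 𝓝 p, DifferentiableAt ℝ f x :=
    fun hf => (hf.eventually (by simp)).mono fun x hx => hx.differentiableAt two_ne_zero
  have hd2 : ∀ {f : E → ℝ}, ContDiffAt ℝ 2 f p → DifferentiableAt ℝ (fderiv ℝ f) p :=
    fun hf => (hf.fderiv_right (m := 1) one_add_one_eq_two.le).differentiableAt one_ne_zero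
  have h : (fderiv ℝ fun x => u x - v x) =ᶠ[𝓝 p] fun x => fderiv ℝ u x - fderiv ℝ v x := by
    filter_upwards [hd hu, hd hv] with x hx hx' using fderiv_fun_sub hx hx'
  rw [h.fderiv_eq, fderiv_fun_sub (hd2 hu) (hd2 hv)]

theorem ContDiffAt.fderiv_fderiv_nonneg {E : Type*} [NormedAddCommGroup E] [NormedSpace ℝ E]
    {u : E → ℝ} {p : E} (hu : ContDiffAt ℝ 2 u p) (hmin : IsLocalMin u p) (ξ : E) :
    0 ≤ fderiv ℝ (fderiv ℝ u) p ξ ξ := by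
  obtain ⟨h1, h2⟩ := hu.hasDerivAt_line ξ
  have h0 : p + (0 : ℝ) • ξ = p := by simp
  have hc : ContinuousAt (fun t : ℝ => p + t • ξ) 0 := by fun_prop
  have ht : Tendsto (fun t : ℝ => p + t • ξ) (𝓝 0) (𝓝 p) := by
    have := hc.tendsto
    rwa [h0] at this
  have := nonpos_of_isLocalMax_of_hasDerivAt (f := fun t : ℝ => -u (p + t • ξ)) ?_
    (h1.mono fun t ht => ht.neg) h2.neg
  · linarith
  · filter_upwards [ht.eventually hmin] with t h
    simpa [h0] using h

/-- Second derivatives transform tensorially under an affine change of variables. -/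
theorem fderiv_fderiv_eq_of_eventuallyEq_affine {E F : Type*} [NormedAddCommGroup E]
    [NormedSpace ℝ E] [NormedAddCommGroup F] [NormedSpace ℝ F] {u : E → ℝ} {v : F → ℝ}
    {g : E →L[ℝ] F} {c : F} {p : E} (hv : ContDiffAt ℝ 2 v (g p + c))
    (huv : u =ᶠ[𝓝 p] fun y => v (g y + c)) :
    fderiv ℝ (fderiv ℝ u) p = (fderiv ℝ (fderiv ℝ v) (g p + c)).bilinearComp g g := by
  have haff : ∀ y, HasFDerivAt (fun y => g y + c) g y := fun y => g.hasFDerivAt.add_const c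
  have hd : ∀ᶠ x in 𝓝 (g p + c), DifferentiableAt ℝ v x :=
    (hv.eventually (by simp)).mono fun x hx => hx.differentiableAt two_ne_zero
  have h1 : fderiv ℝ u =ᶠ[𝓝 p] fun y => (fderiv ℝ v (g y + c)).comp g := by
    filter_upwards [huv.eventually_nhds, (haff p).continuousAt.eventually hd] with y hy hvy
    rw [Filter.EventuallyEq.fderiv_eq hy]
    exact (hvy.hasFDerivAt.comp y (haff y)).fderiv
  have hd2 : HasFDerivAt (fderiv ℝ v) (fderiv ℝ (fderiv ℝ v) (g p + c)) (g p + c) :=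
    ((hv.fderiv_right (m := 1) one_add_one_eq_two.le).differentiableAt one_ne_zero).hasFDerivAt
  have h2 : HasFDerivAt (fun y => fderiv ℝ v (g y + c))
      ((fderiv ℝ (fderiv ℝ v) (g p + c)).comp g) p := hd2.comp p (haff p)
  have h3 : HasFDerivAt (fun y => (fderiv ℝ v (g y + c)).comp g) _ p :=
    ((ContinuousLinearMap.compL ℝ E F ℝ).flip g).hasFDerivAt.comp p h2
  rw [h1.fderiv_eq, h3.fderiv]
  ext v w
  rfl

end SecondDerivatives

/-! ### The strong maximum principle -/

section StrongMaximum

open Filter Topology Metric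

section InnerProductSpace

variable {E : Type*} [NormedAddCommGroup E] [InnerProductSpace ℝ E]

/-- The closed ball with diameter `[y, z]` meets the sphere around `y` through `z` only in `z`. -/
theorem dist_lt_of_norm_sub_midpoint_le {x y z : E} (hxz : x ≠ z)
    (h : 0 ≤ ‖z - midpoint ℝ y z‖ ^ 2 - ‖x - midpoint ℝ y z‖ ^ 2) : dist x y < dist z y := by
  set c := midpoint ℝ y z with hc
  have hcy : c - y = z - c := by
    rw [hc, midpoint_eq_smul_add, invOf_eq_inv]
    module
  have h1 : x - y = (x - c) + (z - c) := by rw [← hcy]; abel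
  have h2 : z - y = (2 : ℝ) • (z - c) := by
    rw [two_smul]; nth_rw 1 [← hcy]; abel
  have h3 := parallelogram_law_with_norm ℝ (x - c) (z - c)
  have h4 : 0 < ‖(x - c) - (z - c)‖ := by
    rw [sub_sub_sub_cancel_right]
    exact norm_pos_iff.2 (sub_ne_zero.2 hxz)
  rw [dist_eq_norm, dist_eq_norm]
  refine lt_of_pow_lt_pow_left₀ 2 (norm_nonneg _) ?_
  rw [h1, h2, norm_smul, mul_pow]
  norm_num
  nlinarith

/-- Hopf's strong maximum principle for the operator `w ↦ ∑ k, D²w(ξ k, ξ k)`, which is elliptic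
because the directions `ξ k` span. Take a point `y` near `x₀` with `w y < m` and a nearest point `z`
of the contact set `w = m`. With `c` the midpoint of `y` and `z` and `s x = ‖z - c‖² - ‖x - c‖²`,
the barrier `s + K s²` is for large `K` a strict subsolution near `z`, and adding a small multiple
of it to `w` produces an interior maximum, where the second derivative test fails. -/
theorem eventually_eq_of_sum_fderiv_fderiv_nonneg_of_inner [FiniteDimensional ℝ E] {ι : Type*}
    [Fintype ι] {U : Set E} (hU : IsOpen U) {w : E → ℝ} (hw : ContDiffOn ℝ 2 w U) {ξ : ι → E → E}
    (hξ : ∀ k, ContinuousOn (ξ k) U)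
    (hspan : ∀ p ∈ U, ∀ v : E, (∀ k, inner ℝ v (ξ k p) = 0) → v = 0)
    (hL : ∀ p ∈ U, 0 ≤ ∑ k, fderiv ℝ (fderiv ℝ w) p (ξ k p) (ξ k p))
    {m : ℝ} (hm : ∀ p ∈ U, w p ≤ m) {x₀ : E} (hx₀ : x₀ ∈ U) (hwx₀ : w x₀ = m) :
    ∀ᶠ x in 𝓝 x₀, w x = m := by
  have : ProperSpace E := FiniteDimensional.proper ℝ E
  obtain ⟨r', hr', hr'U⟩ := Metric.isOpen_iff.1 hU x₀ hx₀
  set r := r' / 3 with hr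
  have hr0 : 0 < r := by positivity
  have hBU : closedBall x₀ (2 * r) ⊆ U :=
    (closedBall_subset_ball (by rw [hr]; linarith)).trans hr'U
  have hwc : ContinuousOn w U := hw.continuousOn
  refine Metric.eventually_nhds_iff_ball.2 ⟨r, hr0, fun y hy => ?_⟩
  by_contra hwy
  -- the contact set, and a contact point nearest to `y`
  set Z := closedBall x₀ (2 * r) ∩ w ⁻¹' {m} with hZ
  have hZc : IsCompact Z := (isCompact_closedBall x₀ (2 * r)).of_isClosed_subset
    ((hwc.mono hBU).preimage_isClosed_of_isClosed isClosed_closedBall isClosed_singleton)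
    Set.inter_subset_left
  have hx₀Z : x₀ ∈ Z := ⟨mem_closedBall_self (by positivity), hwx₀⟩
  obtain ⟨z, hzZ, hz⟩ := hZc.exists_infDist_eq_dist ⟨x₀, hx₀Z⟩ y
  have hzy : dist y z < r := by
    rw [← hz]
    exact (infDist_le_dist_of_mem hx₀Z).trans_lt (mem_ball.1 hy)
  have hwz : w z = m := hzZ.2
  have hyz : y ≠ z := fun h => hwy (h ▸ hwz)
  have hlt : ∀ x, dist x y < dist z y → w x < m := by
    intro x hx
    have hxB : x ∈ closedBall x₀ (2 * r) := by
      rw [mem_closedBall]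
      have := dist_triangle x y x₀
      rw [dist_comm z y] at hx
      have := mem_ball.1 hy
      linarith
    refine lt_of_le_of_ne (hm x (hBU hxB)) fun h => ?_
    have := infDist_le_dist_of_mem (x := y) (show x ∈ Z from ⟨hxB, h⟩)
    rw [hz, dist_comm y x, dist_comm y z] at this
    linarith
  have hz2 : z ∈ ball x₀ (2 * r) := by
    rw [mem_ball]
    have := dist_triangle z y x₀
    rw [dist_comm z y] at this
    have := mem_ball.1 hy
    linarith
  -- the barrier `s + K * s ^ 2`
  set c := midpoint ℝ y z with hc
  set s : E → ℝ := fun x => ‖z - c‖ ^ 2 - ‖x - c‖ ^ 2 with hs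
  have hsc : Continuous s := by fun_prop
  have hsz : s z = 0 := by simp [hs]
  have hzc : z - c ≠ 0 := by
    intro h
    have h' : z = midpoint ℝ y z := sub_eq_zero.1 h
    exact hyz ((right_eq_midpoint_iff ..).1 h')
  have hBpos : 0 < ∑ k, inner ℝ (z - c) (ξ k z) ^ 2 := by
    refine lt_of_le_of_ne (Finset.sum_nonneg fun k _ => sq_nonneg _) fun h => hzc ?_
    refine hspan z (hBU (ball_subset_closedBall hz2)) _ fun k => ?_
    have := (Finset.sum_eq_zero_iff_of_nonneg (fun k _ => sq_nonneg _)).1 h.symm k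
      (Finset.mem_univ k)
    exact pow_eq_zero_iff two_ne_zero |>.1 this
  set B := ∑ k, inner ℝ (z - c) (ξ k z) ^ 2
  set A := ∑ k, ‖ξ k z‖ ^ 2 with hA
  have hA0 : 0 ≤ A := Finset.sum_nonneg fun k _ => sq_nonneg _
  -- large enough that the operator applied to the barrier is positive at `z`
  set K := (A + 1) / (4 * B) with hK
  have hK0 : 0 < K := by positivity
  -- half of the operator applied to the barrier
  set Q : E → ℝ := fun x => ∑ k, (-‖ξ k x‖ ^ 2 +
    K * (4 * inner ℝ (x - c) (ξ k x) ^ 2 - 2 * s x * ‖ξ k x‖ ^ 2)) with hQ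
  have hQc : ContinuousOn Q U := by
    refine continuousOn_finsetSum _ fun k _ => ?_
    have := hξ k
    have := hsc.continuousOn (s := U)
    fun_prop
  have hQz : 0 < Q z := by
    have : Q z = -A + K * (4 * B) := by
      simp only [hQ, hsz, Finset.sum_add_distrib, Finset.sum_neg_distrib, ← Finset.mul_sum,
        mul_zero, zero_mul, sub_zero]
      rfl
    rw [this, hK, div_mul_cancel₀ _ (by positivity)]
    linarith
  have hnear : ∀ᶠ x in 𝓝 z, x ∈ ball x₀ (2 * r) ∧ 0 < Q x ∧ 0 < 1 + K * s x := by
    have hzU := hU.mem_nhds (hBU (ball_subset_closedBall hz2))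
    refine Filter.Eventually.and (isOpen_ball.mem_nhds hz2) (Filter.Eventually.and
      ((hQc.continuousAt hzU).eventually (lt_mem_nhds hQz)) ?_)
    have : ContinuousAt (fun x => 1 + K * s x) z := by fun_prop
    exact this.eventually (lt_mem_nhds (by simp [hsz]))
  obtain ⟨ρ, hρ, hρ'⟩ := Metric.nhds_basis_closedBall.eventually_iff.1 hnear
  set h : E → ℝ := fun x => s x * (1 + K * s x) with hh
  have hhc : Continuous h := by fun_prop
  have hρU : closedBall z ρ ⊆ U := fun x hx => hBU (ball_subset_closedBall (hρ' hx).1)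
  have hwρ : ContinuousOn w (closedBall z ρ) := hwc.mono hρU
  -- `w` is bounded away from `m` on the part of the sphere where the barrier is nonnegative
  obtain ⟨δ, hδ, hδ'⟩ : ∃ δ > 0, ∀ x ∈ sphere z ρ, 0 ≤ s x → w x ≤ m - δ := by
    set T := sphere z ρ ∩ s ⁻¹' Set.Ici 0
    have hT : IsCompact T := (isCompact_sphere z ρ).inter_right (isClosed_Ici.preimage hsc)
    rcases T.eq_empty_or_nonempty with hTe | hTn
    · exact ⟨1, one_pos, fun x hx hsx => absurd (show x ∈ T from ⟨hx, hsx⟩) (by simp [hTe])⟩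
    · obtain ⟨x₁, hx₁, hmax⟩ := hT.exists_isMaxOn hTn
        (hwρ.mono (Set.inter_subset_left.trans sphere_subset_closedBall))
      refine ⟨m - w x₁, sub_pos.2 (hlt x₁ (dist_lt_of_norm_sub_midpoint_le ?_ hx₁.2)),
        fun x hx hsx => ?_⟩
      · rintro rfl
        have := hx₁.1
        simp at this
        exact hρ.ne this
      · have := hmax (show x ∈ T from ⟨hx, hsx⟩)
        simp only [Set.mem_ofPred_eq] at this
        linarith
  obtain ⟨H, hH⟩ := ((isCompact_closedBall z ρ).bddAbove_image hhc.continuousOn)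
  have hH' : ∀ x ∈ closedBall z ρ, h x ≤ |H| + 1 := fun x hx =>
    (hH (Set.mem_image_of_mem h hx)).trans ((le_abs_self H).trans (by linarith))
  set ε := δ / (2 * (|H| + 1)) with hε
  have hε0 : 0 < ε := by positivity
  have hεH : ε * (|H| + 1) = δ / 2 := by
    rw [hε]; field_simp
  obtain ⟨p, hp, hpmax⟩ := (isCompact_closedBall z ρ).exists_isMaxOn
    ⟨z, mem_closedBall_self hρ.le⟩ (hwρ.add (hhc.const_mul ε).continuousOn)
  have hvp : m ≤ w p + ε * h p := by
    have := hpmax (mem_closedBall_self hρ.le)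
    simpa [hh, hsz, hwz] using this
  have hpball : p ∈ ball z ρ := by
    by_contra hpb
    have hps : p ∈ sphere z ρ := by
      rw [mem_sphere]
      exact le_antisymm (mem_closedBall.1 hp) (not_lt.1 hpb)
    rcases le_or_gt 0 (s p) with h0 | h0
    · have h1 := hδ' p hps h0
      have h2 := mul_le_mul_of_nonneg_left (hH' p hp) hε0.le
      linarith
    · have h1 : h p < 0 := mul_neg_of_neg_of_pos h0 (hρ' hp).2.2
      have h2 := mul_neg_of_pos_of_neg hε0 h1
      have h3 := hm p (hρU hp)
      linarith
  have hloc : IsLocalMax (fun x => w x + ε * h x) p := by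
    filter_upwards [isOpen_ball.mem_nhds hpball] with x hx using hpmax (ball_subset_closedBall hx)
  have hpU := hρU hp
  -- the barrier is a quartic on lines, and its quadratic coefficient is a summand of `Q`
  have hk : ∀ k, fderiv ℝ (fderiv ℝ w) p (ξ k p) (ξ k p) + 2 * (ε * (-‖ξ k p‖ ^ 2 +
      K * (4 * inner ℝ (p - c) (ξ k p) ^ 2 - 2 * s p * ‖ξ k p‖ ^ 2))) ≤ 0 := by
    intro k
    set b := inner ℝ (p - c) (ξ k p)
    set n := ‖ξ k p‖ ^ 2 with hn
    refine ContDiffAt.fderiv_fderiv_add_nonpos (hw.contDiffAt (hU.mem_nhds hpU))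
      (c₀ := ε * h p) (c₁ := ε * (-2 * b - 4 * K * s p * b)) (c₃ := ε * (4 * K * b * n))
      (c₄ := ε * (K * n ^ 2)) (fun t => ?_) hloc
    have hst : s (p + t • ξ k p) = s p - 2 * t * b - t ^ 2 * n := by
      simp only [hs]
      rw [add_sub_right_comm, norm_add_sq_real, inner_smul_right, norm_smul, mul_pow, hn]
      simp only [Real.norm_eq_abs, sq_abs]
      ring
    simp only [hh, hst]
    ring
  have hsum := Finset.sum_nonpos fun k (_ : k ∈ Finset.univ) => hk k
  rw [Finset.sum_add_distrib, ← Finset.mul_sum, ← Finset.mul_sum] at hsum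
  have h1 := hL p hpU
  have h2 : 0 < ε * Q p := mul_pos hε0 (hρ' hp).2.1
  simp only [hQ] at h2
  linarith

end InnerProductSpace

/-- Hopf's strong maximum principle on a finite-dimensional normed space. -/
theorem eventually_eq_of_sum_fderiv_fderiv_nonneg {E : Type*} [NormedAddCommGroup E]
    [NormedSpace ℝ E] [FiniteDimensional ℝ E] {ι : Type*} [Fintype ι]
    {U : Set E} (hU : IsOpen U) {w : E → ℝ} (hw : ContDiffOn ℝ 2 w U) {ξ : ι → E → E}
    (hξ : ∀ k, ContinuousOn (ξ k) U)
    (hspan : ∀ p ∈ U, ∀ ℓ : E →L[ℝ] ℝ, (∀ k, ℓ (ξ k p) = 0) → ℓ = 0)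
    (hL : ∀ p ∈ U, 0 ≤ ∑ k, fderiv ℝ (fderiv ℝ w) p (ξ k p) (ξ k p))
    {m : ℝ} (hm : ∀ p ∈ U, w p ≤ m) {x₀ : E} (hx₀ : x₀ ∈ U) (hwx₀ : w x₀ = m) :
    ∀ᶠ x in 𝓝 x₀, w x = m := by
  let T : E ≃L[ℝ] EuclideanSpace ℝ (Fin (Module.finrank ℝ E)) := toEuclidean
  have hmap : Set.MapsTo T.symm (T.symm ⁻¹' U) U := Set.mapsTo_preimage _ _
  have key := eventually_eq_of_sum_fderiv_fderiv_nonneg_of_inner (hU.preimage T.symm.continuous)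
    (w := w ∘ T.symm) (hw.comp T.symm.contDiff.contDiffOn hmap)
    (ξ := fun k q => T (ξ k (T.symm q)))
    (fun k => T.continuous.comp_continuousOn ((hξ k).comp T.symm.continuous.continuousOn hmap))
    ?_ ?_ (fun q hq => hm _ hq) (x₀ := T x₀) (by simpa using hx₀) (by simpa using hwx₀)
  · have := T.continuous.continuousAt.eventually key
    simpa using this
  · intro q hq v hv
    have h0 := hspan _ hq ((innerSL ℝ v).comp (T : E →L[ℝ] _)) (by simpa using hv)
    have h1 := congrArg (fun f => f (T.symm v)) h0
    simpa using h1
  · intro q hq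
    have h1 : fderiv ℝ (fderiv ℝ (w ∘ T.symm)) q =
        (fderiv ℝ (fderiv ℝ w) (T.symm q)).bilinearComp (T.symm : _ →L[ℝ] E)
          (T.symm : _ →L[ℝ] E) := by
      have hq' : ContDiffAt ℝ 2 w ((T.symm : _ →L[ℝ] E) q + 0) := by
        rw [add_zero]; exact hw.contDiffAt (hU.mem_nhds hq)
      have := fderiv_fderiv_eq_of_eventuallyEq_affine (u := w ∘ T.symm) hq'
        (Eventually.of_forall fun y => by simp)
      simpa using this
    simpa [h1] using hL _ hq

end StrongMaximum

/-! ### Octonion identities -/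

namespace Octonion

/-- Left multiplication by `star x` is the adjoint of left multiplication by `x`. -/
theorem inner_mul_e (x v : Octonion) (a : Fin 8) :
    inner ℝ v (x * e a) = (star x * v) a := by
  fin_cases a <;>
    simp [PiLp.inner_apply, Fin.sum_univ_eight, mul_def, star_def, e] <;> ring

theorem inner_star_mul (x v w : Octonion) :
    inner ℝ (star x * v) w = inner ℝ v (x * w) := by
  simp [PiLp.inner_apply, Fin.sum_univ_eight, mul_def, star_def]
  ring

theorem mul_star_eq_sum (x y : Octonion) :
    x * star y = ∑ a, ∑ b, (x a * y b) • (e a * star (e b)) := by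
  ext k
  fin_cases k <;> simp [Fin.sum_univ_eight, mul_def, star_def, e] <;> ring

/-- The inner product of `q` with the off-diagonal entry of an octonionic Hermitian form. -/
theorem sum_smul_mul_star (S : Fin 8 → Fin 8 → ℝ) (q : Octonion) :
    inner ℝ q (∑ a, ∑ b, S a b • (e a * star (e b))) = ∑ b, ∑ a, (q * e b) a * S a b := by
  simp [PiLp.inner_apply, Fin.sum_univ_eight, mul_def, star_def, e]
  ring

theorem mul_star_mul (x y : Octonion) : x * (star x * y) = ‖x‖ ^ 2 • y := by
  rw [EuclideanSpace.norm_sq_eq]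
  ext i
  fin_cases i <;> simp [Fin.sum_univ_eight, mul_def, star_def] <;> ring

theorem star_star' (x : Octonion) : star (star x) = x := by
  ext i
  fin_cases i <;> simp [star_def]

/-- The octonions `q * e c` are orthogonal, of norm `‖q‖`; this is the statement for the transposed
matrix. -/
theorem sum_mul_e_mul_e (q : Octonion) (a b : Fin 8) :
    ∑ c, (q * e c) a * (q * e c) b = if a = b then ‖q‖ ^ 2 else 0 := by
  have h : ∀ c d, (q * e c) d = (star q * e d) c := fun c d => by
    rw [← inner_mul_e, real_inner_comm, show e d = EuclideanSpace.single d 1 from rfl,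
      EuclideanSpace.inner_single_right]
    simp
  calc ∑ c, (q * e c) a * (q * e c) b = inner ℝ (star q * e a) (star q * e b) := by
        simp_rw [h, PiLp.inner_apply]
        simp [mul_comm]
    _ = if a = b then ‖q‖ ^ 2 else 0 := by
        rw [inner_star_mul, mul_star_mul, inner_smul_right, e, e, EuclideanSpace.inner_single_left]
        simp

set_option maxHeartbeats 1000000 in
/-- The associator is alternating and changes sign under conjugation of an argument, so that
`[star a, x, star y] = -[x, star y, a]`. -/
theorem mul_mul_star_sub (a x y : Octonion) :
    (star a * x) * star y + x * star (star (-a) * y)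
      = star a * (x * star y) - (x * star y) * a := by
  ext k
  fin_cases k <;> simp [mul_def, star_def] <;> ring

theorem mul_mul_star_symm (c x y : Octonion) :
    (star c * x) * star y + (star c * y) * star x = (2 * inner ℝ x y) • star c := by
  ext k
  fin_cases k <;> simp [mul_def, star_def, PiLp.inner_apply, Fin.sum_univ_eight] <;> ring

theorem mul_star_mul_symm (b x y : Octonion) :
    x * star (star b * y) + y * star (star b * x) = (2 * inner ℝ x y) • b := by
  ext k
  fin_cases k <;> simp [mul_def, star_def, PiLp.inner_apply, Fin.sum_univ_eight] <;> ring

theorem mul_ofReal (x : Octonion) (r : ℝ) : x * ofReal r = r • x := by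
  ext k
  fin_cases k <;> simp [mul_def, ofReal, e, mul_comm]

theorem ofReal_mul (x : Octonion) (r : ℝ) : ofReal r * x = r • x := by
  ext k
  fin_cases k <;> simp [mul_def, ofReal, e]

theorem re_star_mul_star (c x y : Octonion) :
    (star c * star (x * star y)).re = inner ℝ (star c * y) x := by
  simp [re, mul_def, star_def, PiLp.inner_apply, Fin.sum_univ_eight]
  ring

theorem re_mul_mul (c x y : Octonion) :
    ((x * star y) * c).re = inner ℝ (star c * y) x := by
  simp [re, mul_def, star_def, PiLp.inner_apply, Fin.sum_univ_eight]
  ring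

theorem re_star_mul_mul (b x y : Octonion) :
    (star b * (x * star y)).re = inner ℝ (star b * x) y := by
  simp [re, mul_def, star_def, PiLp.inner_apply, Fin.sum_univ_eight]
  ring

theorem re_star_mul (b x y : Octonion) :
    (star (x * star y) * b).re = inner ℝ (star b * x) y := by
  simp [re, mul_def, star_def, PiLp.inner_apply, Fin.sum_univ_eight]
  ring

theorem inner_mul_symm (a x y : Octonion) :
    inner ℝ (star a * x) y + inner ℝ x (star a * y) = 2 * inner ℝ x y * a.re := by
  simp [re, mul_def, star_def, PiLp.inner_apply, Fin.sum_univ_eight]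
  ring

theorem re_star (x : Octonion) : (star x).re = x.re := by simp [re, star_def]

theorem re_add (x y : Octonion) : (x + y).re = x.re + y.re := by simp [re]

theorem re_neg (x : Octonion) : (-x).re = -x.re := by simp [re]

theorem re_sub (x y : Octonion) : (x - y).re = x.re - y.re := by simp [re]

theorem re_smul (r : ℝ) (x : Octonion) : (r • x).re = r * x.re := by simp [re]

theorem star_add' (x y : Octonion) : star (x + y) = star x + star y := by
  ext k
  fin_cases k <;> simp [star_def] <;> ring

theorem star_smul' (r : ℝ) (x : Octonion) : star (r • x) = r • star x := by
  ext k
  fin_cases k <;> simp [star_def]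

theorem mul_smul' (r : ℝ) (x y : Octonion) : x * (r • y) = r • (x * y) := by
  ext k
  fin_cases k <;> simp [mul_def] <;> ring

theorem smul_mul' (r : ℝ) (x y : Octonion) : (r • x) * y = r • (x * y) := by
  ext k
  fin_cases k <;> simp [mul_def] <;> ring

theorem re_e_mul_star_e (a b : Fin 8) :
    (e a * star (e b)).re = if a = b then 1 else 0 := by
  fin_cases a <;> fin_cases b <;> simp [re, e, mul_def, star_def]

theorem re_sum_sum (S : Fin 8 → Fin 8 → ℝ) :
    (∑ a, ∑ b, S a b • (e a * star (e b))).re = ∑ a, S a a := by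
  have h : ∀ a b, (S a b • (e a * star (e b))) 0 = S a b * if a = b then 1 else 0 :=
    fun a b => by rw [← re_e_mul_star_e]; rfl
  rw [re]
  simp only [WithLp.ofLp_sum, Finset.sum_apply, h]
  simp

end Octonion

/-! ### The Hermitian matrix of a real bilinear form -/

namespace ContinuousLinearMap

variable {E : Type*} [NormedAddCommGroup E] [NormedSpace ℝ E]

/-- The symmetric product `(ℓ ⊗ m + m ⊗ ℓ) / 2` of two linear functionals, as a bilinear form. -/
def symProd (ℓ m : E →L[ℝ] ℝ) : E →L[ℝ] E →L[ℝ] ℝ :=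
  (1 / 2 : ℝ) • (ℓ.smulRight m + m.smulRight ℓ)

theorem symProd_apply (ℓ m : E →L[ℝ] ℝ) (v w : E) :
    symProd ℓ m v w = 1 / 2 * (ℓ v * m w + m v * ℓ w) := by
  simp [symProd]
  ring

theorem symProd_comm (ℓ m : E →L[ℝ] ℝ) : symProd ℓ m = symProd m ℓ := by
  ext v w
  rw [symProd_apply, symProd_apply, add_comm]

theorem symProd_add_left (ℓ ℓ' m : E →L[ℝ] ℝ) :
    symProd (ℓ + ℓ') m = symProd ℓ m + symProd ℓ' m := by
  ext v w
  simp only [symProd_apply, add_apply]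
  ring

theorem symProd_smul_left (c : ℝ) (ℓ m : E →L[ℝ] ℝ) :
    symProd (c • ℓ) m = c • symProd ℓ m := by
  ext v w
  simp only [symProd_apply, smul_apply, smul_eq_mul]
  ring

end ContinuousLinearMap

theorem OctHerm.toMatrix_entries (X : OctHerm) :
    (X.toMatrix 0 0).re = X.1 ∧ (X.toMatrix 1 1).re = X.2.1 ∧ X.toMatrix 0 1 = X.2.2 := by
  simp [OctHerm.toMatrix, Octonion.re, Octonion.ofReal, Octonion.e]

/-- The octonionic Hermitian matrix with entries `∑ a b, S(∂ᵢᵃ, ∂ⱼᵇ) e_a ē_b` of a symmetric real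
bilinear form `S` on `𝕆²`; by symmetry only the terms with `a = b` remain on the diagonal. For `S`
the second derivative of a function, it is the octonionic Hessian. -/
def octHermForm : (OctPlane →L[ℝ] OctPlane →L[ℝ] ℝ) →ₗ[ℝ] OctHerm where
  toFun S := (∑ a, S (octBasis 0 a) (octBasis 0 a), ∑ a, S (octBasis 1 a) (octBasis 1 a),
    ∑ a, ∑ b, S (octBasis 0 a) (octBasis 1 b) • (Octonion.e a * star (Octonion.e b)))
  map_add' S T := by
    simp [Finset.sum_add_distrib, add_smul]
  map_smul' c S := by
    simp [Finset.mul_sum, Finset.smul_sum, mul_smul]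

theorem octHermForm_fst (S : OctPlane →L[ℝ] OctPlane →L[ℝ] ℝ) :
    (octHermForm S).1 = ∑ a, S (octBasis 0 a) (octBasis 0 a) := rfl

theorem octHermForm_snd_fst (S : OctPlane →L[ℝ] OctPlane →L[ℝ] ℝ) :
    (octHermForm S).2.1 = ∑ a, S (octBasis 1 a) (octBasis 1 a) := rfl

theorem octHermForm_snd_snd (S : OctPlane →L[ℝ] OctPlane →L[ℝ] ℝ) :
    (octHermForm S).2.2 = ∑ a, ∑ b,
      S (octBasis 0 a) (octBasis 1 b) • (Octonion.e a * star (Octonion.e b)) := rfl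

/-- The octonionic Hermitian matrix of the symmetric product of two real functionals on `𝕆²`. -/
def octSymProd : (OctPlane →L[ℝ] ℝ) →L[ℝ] (OctPlane →L[ℝ] ℝ) →L[ℝ] OctHerm :=
  (LinearMap.mk₂ ℝ (fun ℓ m => octHermForm (ℓ.symProd m))
    (fun ℓ ℓ' m => by rw [ℓ.symProd_add_left, LinearMap.map_add])
    (fun c ℓ m => by rw [ℓ.symProd_smul_left, LinearMap.map_smul])
    (fun ℓ m m' => by
      rw [ℓ.symProd_comm, m.symProd_add_left, LinearMap.map_add, m.symProd_comm, m'.symProd_comm])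
    (fun c ℓ m => by
      rw [ℓ.symProd_comm, m.symProd_smul_left, LinearMap.map_smul,
        m.symProd_comm])).toContinuousBilinearMap

theorem octSymProd_apply (ℓ m : OctPlane →L[ℝ] ℝ) :
    octSymProd ℓ m = octHermForm (ℓ.symProd m) := rfl

/-- The real coordinates on `𝕆²`. -/
def octCoord (i : Fin 2) (a : Fin 8) : OctPlane →L[ℝ] ℝ :=
  (EuclideanSpace.proj a).comp (ContinuousLinearMap.proj i)

@[simp]
theorem octCoord_apply (i : Fin 2) (a : Fin 8) (ξ : OctPlane) : octCoord i a ξ = ξ i a := rfl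

theorem octPlane_eq_sum (ξ : OctPlane) : ξ = ∑ i, ∑ a, ξ i a • octBasis i a := by
  funext j
  ext b
  simp only [Finset.sum_apply, Pi.smul_apply, octBasis, Octonion.e, PiLp.smul_apply,
    WithLp.ofLp_sum]
  fin_cases j <;> simp [Fin.sum_univ_two, Pi.single_apply]

/-- A symmetric form is the sum of the symmetric products of the coordinates with its rows. -/
theorem octHermForm_comp {S : OctPlane →L[ℝ] OctPlane →L[ℝ] ℝ} (hS : ∀ v w, S v w = S w v)
    (g : OctPlane →L[ℝ] OctPlane) :
    octHermForm (S.bilinearComp g g) =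
      ∑ i, ∑ a, octSymProd ((octCoord i a).comp g) ((S (octBasis i a)).comp g) := by
  have key : ∀ v w, S v w = ∑ i, ∑ a, v i a * S (octBasis i a) w := by
    intro v w
    conv_lhs => rw [octPlane_eq_sum v]
    simp [map_sum, sum_apply]
  simp only [octSymProd_apply, ← map_sum]
  congr 1
  ext v w
  have h1 := key (g v) (g w)
  have h2 := key (g w) (g v)
  rw [hS (g w)] at h2
  simp only [ContinuousLinearMap.bilinearComp_apply, sum_apply,
    ContinuousLinearMap.symProd_apply, ContinuousLinearMap.comp_apply, octCoord_apply,
    ← Finset.mul_sum, Finset.sum_add_distrib]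
  simp_rw [mul_comm (S _ (g v)), ← h1, ← h2]
  ring

/-- The vector of `𝕆²` that represents a real functional through the Euclidean inner product. -/
def octCoeffs (ℓ : OctPlane →L[ℝ] ℝ) (i : Fin 2) : Octonion :=
  WithLp.toLp 2 fun a => ℓ (octBasis i a)

theorem apply_eq_inner_octCoeffs (ℓ : OctPlane →L[ℝ] ℝ) (ξ : OctPlane) :
    ℓ ξ = ∑ i, inner ℝ (octCoeffs ℓ i) (ξ i) := by
  conv_lhs => rw [octPlane_eq_sum ξ]
  simp [map_sum, octCoeffs, PiLp.inner_apply]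

/-- In terms of the representing vectors `v`, `w`, the Hermitian matrix of a symmetric product is
the symmetrization of `v w*`. -/
theorem octSymProd_eq (ℓ m : OctPlane →L[ℝ] ℝ) :
    octSymProd ℓ m = (inner ℝ (octCoeffs ℓ 0) (octCoeffs m 0),
      inner ℝ (octCoeffs ℓ 1) (octCoeffs m 1),
      (1 / 2 : ℝ) • (octCoeffs ℓ 0 * star (octCoeffs m 1)
        + octCoeffs m 0 * star (octCoeffs ℓ 1))) := by
  refine Prod.ext ?_ (Prod.ext ?_ ?_)
  · simp only [octSymProd_apply, octHermForm_fst, octCoeffs, PiLp.inner_apply,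
      ContinuousLinearMap.symProd_apply]
    refine Finset.sum_congr rfl fun a _ => ?_
    simp; ring
  · simp only [octSymProd_apply, octHermForm_snd_fst, octCoeffs, PiLp.inner_apply,
      ContinuousLinearMap.symProd_apply]
    refine Finset.sum_congr rfl fun a _ => ?_
    simp; ring
  · simp only [octSymProd_apply, octHermForm_snd_snd, ContinuousLinearMap.symProd_apply]
    rw [Octonion.mul_star_eq_sum, Octonion.mul_star_eq_sum, ← Finset.sum_add_distrib,
      Finset.smul_sum]
    refine Finset.sum_congr rfl fun a _ => ?_
    rw [← Finset.sum_add_distrib, Finset.smul_sum]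
    refine Finset.sum_congr rfl fun b _ => ?_
    rw [← add_smul, smul_smul]
    rfl

/-- Precomposition with an octonionic matrix acts on the representing vectors by its adjoint. -/
theorem octCoeffs_comp {A : OctMatrix} {Z : OctPlane →L[ℝ] OctPlane} (hZ : ∀ ξ, Z ξ = A *ᵥ ξ)
    (ℓ : OctPlane →L[ℝ] ℝ) (i : Fin 2) :
    octCoeffs (ℓ.comp Z) i = ∑ k, star (A k i) * octCoeffs ℓ k := by
  ext a
  rw [octCoeffs]
  simp only [ContinuousLinearMap.comp_apply, hZ, apply_eq_inner_octCoeffs ℓ, WithLp.ofLp_sum,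
    Finset.sum_apply, ← Octonion.inner_mul_e]
  refine Finset.sum_congr rfl fun k _ => ?_
  congr 1
  fin_cases i <;> simp [Matrix.mulVec, dotProduct, octBasis]

theorem octHermForm_sub (S T : OctPlane →L[ℝ] OctPlane →L[ℝ] ℝ) :
    octHermForm (S - T) = octHermForm S - octHermForm T := by
  refine eq_sub_of_add_eq ?_
  rw [← LinearMap.map_add]
  congr 1
  ext v w
  simp

theorem continuous_octHermForm : Continuous octHermForm := by
  have h : ∀ v w, Continuous fun S : OctPlane →L[ℝ] OctPlane →L[ℝ] ℝ => S v w := fun v w =>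
    ((ContinuousLinearMap.apply ℝ ℝ w).comp
      (ContinuousLinearMap.apply ℝ (OctPlane →L[ℝ] ℝ) v)).continuous
  exact (continuous_finsetSum _ fun a _ => h _ _).prodMk
    ((continuous_finsetSum _ fun a _ => h _ _).prodMk
      (continuous_finsetSum _ fun a _ => continuous_finsetSum _ fun b _ =>
        (h _ _).smul continuous_const))

/-! ### Equivariance under `GL₂(𝕆)` -/

/-- The linear algebra that combines the octonionic identities for the off-diagonal entry. -/
theorem half_smul_add_eq_zero {V : Type*} [AddCommGroup V] [Module ℝ V]
    {x₁ x₂ x₃ x₄ x₅ x₆ x₇ x₈ y₁ y₂ y₃ y₄ b c : V} {r s : ℝ} (h₁ : x₁ + x₂ = y₁ - y₂)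
    (h₂ : x₃ + x₄ = y₃ - y₄) (h₃ : x₅ + x₆ = (2 * r) • c) (h₄ : x₇ + x₈ = (2 * s) • b) :
    (1 / 2 : ℝ) • (x₁ + x₅ + (x₈ + x₄)) + (1 / 2 : ℝ) • (x₇ + x₂ + (x₃ + x₆)) +
      (-((1 / 2 : ℝ) • (y₁ + y₃) + r • c) - (s • b + (1 / 2 : ℝ) • (-y₂ + -y₄))) = 0 := by
  linear_combination (norm := module) (1 / 2 : ℝ) • h₁ + (1 / 2 : ℝ) • h₂ + (1 / 2 : ℝ) • h₃
    + (1 / 2 : ℝ) • h₄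

set_option maxHeartbeats 1000000 in
open Octonion in
/-- Infinitesimal equivariance under a traceless matrix `A`: with `v`, `w` representing `ℓ`, `m`,
this is `(A* v) w* + v (A* w)* = A* (v w*) + (v w*) A` after symmetrization in `v` and `w`.
Tracelessness makes the two associators in the off-diagonal entry cancel. -/
theorem octSymProd_comp_generator {A : OctMatrix} (hA : A 0 0 + A 1 1 = 0)
    {Z : OctPlane →L[ℝ] OctPlane} (hZ : ∀ ξ, Z ξ = A *ᵥ ξ) {B : OctHerm →L[ℝ] OctHerm}
    (hB : ∀ X, (B X).toMatrix = -(Aᴴ * X.toMatrix) - X.toMatrix * A)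
    (ℓ m : OctPlane →L[ℝ] ℝ) :
    octSymProd (ℓ.comp Z) m + octSymProd ℓ (m.comp Z) + B (octSymProd ℓ m) = 0 := by
  have hB' : ∀ X, B X = ((-(Aᴴ * X.toMatrix) - X.toMatrix * A) 0 0 |>.re,
      (-(Aᴴ * X.toMatrix) - X.toMatrix * A) 1 1 |>.re,
      (-(Aᴴ * X.toMatrix) - X.toMatrix * A) 0 1) := fun X => by
    rw [← hB]
    simp [OctHerm.toMatrix_entries]
  rw [hB', octSymProd_eq, octSymProd_eq, octSymProd_eq]
  simp only [octCoeffs_comp hZ, Fin.sum_univ_two]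
  generalize octCoeffs ℓ 0 = v₀
  generalize octCoeffs ℓ 1 = v₁
  generalize octCoeffs m 0 = w₀
  generalize octCoeffs m 1 = w₁
  have hA1 : A 1 1 = - A 0 0 := by rw [eq_neg_iff_add_eq_zero, add_comm, hA]
  simp only [Matrix.sub_apply, Matrix.neg_apply, Matrix.mul_apply, Fin.sum_univ_two,
    Matrix.conjTranspose_apply, OctHerm.toMatrix, hA1, Matrix.of_apply, Matrix.cons_val',
    Matrix.cons_val_zero, Matrix.cons_val_one, Matrix.cons_val_fin_one]
  generalize A 0 0 = a
  generalize A 0 1 = b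
  generalize A 1 0 = c
  refine Prod.ext ?_ (Prod.ext ?_ ?_)
  · have h := inner_mul_symm a v₀ w₀
    simp only [Prod.fst_add, Prod.fst_zero, mul_ofReal, ofReal_mul, re_star, re_add, re_neg, re_sub,
      re_smul, star_add', star_smul', mul_smul', smul_mul', mul_add, add_mul, re_star_mul_star,
      re_mul_mul, inner_add_left, inner_add_right, real_inner_comm v₀ (_ * w₁)]
    linarith
  · have h := inner_mul_symm (-a) v₁ w₁
    simp only [Prod.fst_add, Prod.snd_add, Prod.fst_zero, Prod.snd_zero, mul_ofReal, ofReal_mul,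
      re_star, re_add, re_neg, re_sub,
      re_smul, star_add', star_smul', mul_smul', smul_mul', mul_add, add_mul, re_star_mul_mul,
      re_star_mul,
      inner_add_left, inner_add_right, real_inner_comm v₁ (_ * w₀)] at h ⊢
    linarith
  · have h1 := mul_mul_star_sub a v₀ w₁
    have h2 := mul_mul_star_sub a w₀ v₁
    have h3 := mul_mul_star_symm c v₁ w₁
    have h4 := mul_star_mul_symm b v₀ w₀
    simp only [Prod.snd_add, Prod.snd_zero, mul_ofReal, ofReal_mul,
      star_add', star_smul', mul_smul', smul_mul', mul_add, add_mul, mul_neg (_ * _) a]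
    exact half_smul_add_eq_zero h1 h2 h3 h4

section Infinitesimal

attribute [local instance] LieRing.ofAssociativeRing LieAlgebra.ofAssociativeAlgebra

/-- Infinitesimal equivariance holds on the Lie algebra that is generated, being preserved by
brackets. -/
theorem octSymProd_comp_add_of_mem {Z : (OctPlane →L[ℝ] OctPlane) × (OctHerm →L[ℝ] OctHerm)}
    (hZ : Z ∈ sl2OctActGraph) : ∀ ℓ m : OctPlane →L[ℝ] ℝ,
    octSymProd (ℓ.comp Z.1) m + octSymProd ℓ (m.comp Z.1) + Z.2 (octSymProd ℓ m) = 0 := by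
  induction hZ using LieSubalgebra.lieSpan_induction with
  | mem Z hZ =>
    obtain ⟨A, hA, h1, h2⟩ := hZ
    exact octSymProd_comp_generator hA h1 h2
  | zero => intro ℓ m; simp
  | add Z Z' _ _ h h' =>
    intro ℓ m
    have := congrArg₂ (· + ·) (h ℓ m) (h' ℓ m)
    simp only [add_zero] at this
    rw [← this]
    simp only [Prod.fst_add, Prod.snd_add, ContinuousLinearMap.comp_add, map_add,
      add_apply]
    abel
  | smul c Z _ h =>
    intro ℓ m
    have := congrArg (c • ·) (h ℓ m)
    simp only [smul_zero] at this
    rw [← this]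
    simp only [Prod.smul_fst, Prod.smul_snd, ContinuousLinearMap.comp_smul, map_smul,
      smul_apply, smul_add]
  | lie Z Z' _ _ h h' =>
    intro ℓ m
    have e1 : (⁅Z, Z'⁆).1 = Z.1 * Z'.1 - Z'.1 * Z.1 := rfl
    have e2 : (⁅Z, Z'⁆).2 = Z.2 * Z'.2 - Z'.2 * Z.2 := rfl
    have key : ∀ (A A' : OctPlane →L[ℝ] OctPlane) (n : OctPlane →L[ℝ] ℝ),
        n.comp (A * A' - A' * A) = (n.comp A).comp A' - (n.comp A').comp A := fun A A' n => by
      ext; simp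
    rw [e1, e2, key, key]
    simp only [map_sub, sub_apply, mul_apply_eq_comp]
    have a1 := h' (ℓ.comp Z.1) m
    have a2 := h (ℓ.comp Z'.1) m
    have a3 := h' ℓ (m.comp Z.1)
    have a4 := h ℓ (m.comp Z'.1)
    have a5 := congrArg Z.2 (h' ℓ m)
    have a6 := congrArg Z'.2 (h ℓ m)
    simp only [map_add, map_zero] at a5 a6
    linear_combination (norm := module) a1 - a2 + a3 - a4 - a6 + a5
end Infinitesimal

/-- Infinitesimal equivariance integrates to one-parameter groups. -/
theorem octSymProd_comp_exp {A : OctPlane →L[ℝ] OctPlane} {B : OctHerm →L[ℝ] OctHerm}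
    (h : ∀ ℓ m : OctPlane →L[ℝ] ℝ,
      octSymProd (ℓ.comp A) m + octSymProd ℓ (m.comp A) + B (octSymProd ℓ m) = 0)
    (ℓ m : OctPlane →L[ℝ] ℝ) :
    NormedSpace.exp B (octSymProd (ℓ.comp (NormedSpace.exp A)) (m.comp (NormedSpace.exp A)))
      = octSymProd ℓ m := by
  let F : ℝ → OctHerm := fun t => NormedSpace.exp (t • B)
    (octSymProd (ℓ.comp (NormedSpace.exp (t • A))) (m.comp (NormedSpace.exp (t • A))))
  have hc : ∀ (n : OctPlane →L[ℝ] ℝ) t, HasDerivAt (fun t : ℝ => n.comp (NormedSpace.exp (t • A)))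
      ((n.comp (NormedSpace.exp (t • A))).comp A) t := fun n t => by
    have := (hasDerivAt_const t n).clm_comp (hasDerivAt_exp_smul_const A t)
    simpa [ContinuousLinearMap.mul_def, ContinuousLinearMap.comp_assoc] using this
  have hF : ∀ t, HasDerivAt F 0 t := by
    intro t
    have h0 := octSymProd.hasDerivAt_of_bilinear (fun _ => hc ℓ t) (fun _ => hc m t)
    have h1 := (hasDerivAt_exp_smul_const B t).clm_apply h0
    have h2 := congrArg (⇑(NormedSpace.exp (t • B) : OctHerm →L[ℝ] OctHerm))
      (h (ℓ.comp (NormedSpace.exp (t • A))) (m.comp (NormedSpace.exp (t • A))))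
    simp only [map_add, map_zero] at h2
    refine h1.congr_deriv ?_
    rw [← h2]
    simp only [map_add, mul_apply_eq_comp]
    abel
  have := is_const_of_deriv_eq_zero (fun t => (hF t).differentiableAt) (fun t => (hF t).deriv) 1 0
  have hF0 : F 0 = octSymProd ℓ m := by
    simp only [F]
    rw [zero_smul ℝ A, zero_smul ℝ B, NormedSpace.exp_zero, NormedSpace.exp_zero]
    rfl
  have hF1 : F 1 = NormedSpace.exp B
      (octSymProd (ℓ.comp (NormedSpace.exp A)) (m.comp (NormedSpace.exp A))) := by
    simp only [F]
    rw [one_smul ℝ A, one_smul ℝ B]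
  rw [← hF1, this, hF0]

/-- Equivariance of symmetric products under `GL₂(𝕆)`. -/
theorem octSymProd_comp_of_mem {p : (OctPlane →L[ℝ] OctPlane)ˣ × (OctHerm →L[ℝ] OctHerm)ˣ}
    (hp : p ∈ octRhoGraph) : ∀ ℓ m : OctPlane →L[ℝ] ℝ,
    (p.2 : OctHerm →L[ℝ] OctHerm) (octSymProd (ℓ.comp (p.1 : OctPlane →L[ℝ] OctPlane))
      (m.comp (p.1 : OctPlane →L[ℝ] OctPlane))) = octSymProd ℓ m := by
  induction hp using Subgroup.closure_induction with
  | mem p hp =>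
    intro ℓ m
    rcases hp with ⟨Z, hZ, h1, h2⟩ | ⟨c, hc, h1, h2⟩
    · rw [h1, h2]
      exact octSymProd_comp_exp (octSymProd_comp_add_of_mem hZ) ℓ m
    · rw [h1, h2]
      have : ∀ n : OctPlane →L[ℝ] ℝ,
          n.comp (c • (1 : OctPlane →L[ℝ] OctPlane)) = c • n := fun n => by
        ext; simp
      simp only [this, map_smul, smul_apply, one_apply_eq_self, smul_smul]
      rw [show c * c * (c ^ 2)⁻¹ = 1 by field_simp, one_smul]
  | one => intro ℓ m; rfl
  | mul p q _ _ hp hq =>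
    intro ℓ m
    have := congrArg (p.2 : OctHerm →L[ℝ] OctHerm)
      (hq (ℓ.comp (p.1 : OctPlane →L[ℝ] OctPlane)) (m.comp (p.1 : OctPlane →L[ℝ] OctPlane)))
    rw [hp] at this
    rw [← this]
    rfl
  | inv p _ hp =>
    intro ℓ m
    have hinv : ∀ X, (p.2⁻¹ : (OctHerm →L[ℝ] OctHerm)ˣ).1 (p.2.1 X) = X := fun X => by
      rw [← mul_apply_eq_comp, Units.inv_mul]; rfl
    have hc : ∀ n : OctPlane →L[ℝ] ℝ, (n.comp (p⁻¹.1 : OctPlane →L[ℝ] OctPlane)).comp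
        (p.1 : OctPlane →L[ℝ] OctPlane) = n := fun n => by
      rw [ContinuousLinearMap.comp_assoc, ← ContinuousLinearMap.mul_def, Prod.fst_inv,
        Units.inv_mul]
      rfl
    have := hp (ℓ.comp (p⁻¹.1 : OctPlane →L[ℝ] OctPlane)) (m.comp (p⁻¹.1 : OctPlane →L[ℝ] OctPlane))
    rw [hc, hc] at this
    rw [← this]
    exact hinv _

/-- Equivariance of the octonionic Hermitian matrix of a symmetric bilinear form: pulling back by
`g` undoes `ρ(g)`. -/
theorem octHermForm_comp_of_mem {p : (OctPlane →L[ℝ] OctPlane)ˣ × (OctHerm →L[ℝ] OctHerm)ˣ}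
    (hp : p ∈ octRhoGraph) {S : OctPlane →L[ℝ] OctPlane →L[ℝ] ℝ} (hS : ∀ v w, S v w = S w v) :
    (p.2 : OctHerm →L[ℝ] OctHerm) (octHermForm (S.bilinearComp (p.1 : OctPlane →L[ℝ] OctPlane)
      (p.1 : OctPlane →L[ℝ] OctPlane))) = octHermForm S := by
  have h := octHermForm_comp hS (.id ℝ OctPlane)
  have hid : S.bilinearComp (.id ℝ OctPlane) (.id ℝ OctPlane) = S := rfl
  rw [hid] at h
  rw [h, octHermForm_comp hS]
  simp only [map_sum, octSymProd_comp_of_mem hp, ContinuousLinearMap.comp_id]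

/-- A positive semidefinite matrix `X` with positive corner entry is a sum of two squares `v v*`, by
the Cholesky decomposition. -/
theorem exists_octSymProd_add {X : OctHerm} (ha : 0 < X.1)
    (hX : 0 ≤ X.1 * X.2.1 - ‖X.2.2‖ ^ 2) :
    ∃ ℓ m, X = octSymProd ℓ ℓ + octSymProd m m := by
  have hsurj : ∀ v : OctPlane, ∃ ℓ, octCoeffs ℓ = v := fun v =>
    ⟨∑ i, (innerSL ℝ (v i)).comp (ContinuousLinearMap.proj i), by
      ext i a
      fin_cases i <;>
        simp [octCoeffs, Fin.sum_univ_two, octBasis, Octonion.e, EuclideanSpace.inner_single_right]⟩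
  have hsq : ∀ q : Octonion, star (star q) = q := Octonion.star_star'
  obtain ⟨a, b, q⟩ := X
  simp only at ha hX
  obtain ⟨ℓ, hℓ⟩ := hsurj ![Octonion.ofReal (√a), (√a)⁻¹ • star q]
  obtain ⟨m, hm⟩ := hsurj ![0, Octonion.ofReal (√((a * b - ‖q‖ ^ 2) / a))]
  have hs : √a ^ 2 = a := Real.sq_sqrt ha.le
  have hs0 : √a ≠ 0 := (Real.sqrt_pos.2 ha).ne'
  have hs2 : √((a * b - ‖q‖ ^ 2) / a) ^ 2 = (a * b - ‖q‖ ^ 2) / a := Real.sq_sqrt (by positivity)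
  have hn : ∀ r : ℝ, ‖Octonion.ofReal r‖ ^ 2 = r ^ 2 := fun r => by
    simp [Octonion.ofReal, Octonion.e, norm_smul]
  have hns : ‖star q‖ = ‖q‖ := by
    simp [EuclideanSpace.norm_eq, Octonion.star_def, Fin.sum_univ_eight]
  refine ⟨ℓ, m, ?_⟩
  rw [octSymProd_eq, octSymProd_eq, hℓ, hm]
  simp only [Matrix.cons_val_zero, Matrix.cons_val_one, real_inner_self_eq_norm_sq, hn, hs, hs2,
    norm_smul, mul_pow, hns, norm_inv, Real.norm_eq_abs, inv_pow, sq_abs]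
  refine Prod.ext ?_ (Prod.ext ?_ ?_)
  · simp
  · simp; field_simp; ring
  · simp [Octonion.ofReal_mul, Octonion.star_smul', hsq, smul_smul, ← add_smul, hs0]
    module

theorem octSymProd_self_fst_nonneg (ℓ : OctPlane →L[ℝ] ℝ) : 0 ≤ (octSymProd ℓ ℓ).1 := by
  rw [octSymProd_eq]; exact real_inner_self_nonneg

/-- The representation `ρ` maps squares `v v*` to squares, so it preserves the cone they span. -/
theorem fst_nonneg_of_mem {p : (OctPlane →L[ℝ] OctPlane)ˣ × (OctHerm →L[ℝ] OctHerm)ˣ}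
    (hp : p ∈ octRhoGraph) {X : OctHerm} (ha : 0 < X.1) (hX : 0 ≤ X.1 * X.2.1 - ‖X.2.2‖ ^ 2) :
    0 ≤ ((p.2 : OctHerm →L[ℝ] OctHerm) X).1 := by
  obtain ⟨ℓ, m, rfl⟩ := exists_octSymProd_add ha hX
  have hc : ∀ n : OctPlane →L[ℝ] ℝ, (n.comp (p⁻¹.1 : OctPlane →L[ℝ] OctPlane)).comp
      (p.1 : OctPlane →L[ℝ] OctPlane) = n := fun n => by
    rw [ContinuousLinearMap.comp_assoc, ← ContinuousLinearMap.mul_def, Prod.fst_inv,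
      Units.inv_mul]
    rfl
  rw [map_add, ← hc ℓ, ← hc m, octSymProd_comp_of_mem hp, octSymProd_comp_of_mem hp]
  exact add_nonneg (octSymProd_self_fst_nonneg _) (octSymProd_self_fst_nonneg _)

/-! ### The octonionic Hessian -/

section Hessian

open Filter Topology

theorem octHess_apply {u : OctPlane → ℝ} {p : OctPlane} (hu : ContDiffAt ℝ 2 u p) (i j : Fin 2) :
    octHess u p i j = ∑ a, ∑ b, fderiv ℝ (fderiv ℝ u) p (octBasis i a) (octBasis j b) •
      (Octonion.e a * star (Octonion.e b)) := by
  have hd : ∀ᶠ x in 𝓝 p, DifferentiableAt ℝ u x :=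
    (hu.eventually (by simp)).mono fun x hx => hx.differentiableAt two_ne_zero
  have h1 : (octD j fun q => Octonion.ofReal (u q)) =ᶠ[𝓝 p] fun q =>
      ∑ b, fderiv ℝ u q (octBasis j b) • star (Octonion.e b) := by
    filter_upwards [hd] with q hq
    have : HasFDerivAt (fun q => Octonion.ofReal (u q))
        ((fderiv ℝ u q).smulRight (Octonion.e 0)) q := hq.hasFDerivAt.smul_const (Octonion.e 0)
    simp only [octD, this.fderiv, ContinuousLinearMap.smulRight_apply]
    exact Finset.sum_congr rfl fun b _ => Octonion.ofReal_mul _ _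
  have hd2 : HasFDerivAt (fderiv ℝ u) (fderiv ℝ (fderiv ℝ u) p) p :=
    ((hu.fderiv_right (m := 1) one_add_one_eq_two.le).differentiableAt one_ne_zero).hasFDerivAt
  have h2 : HasFDerivAt (fun q => ∑ b, fderiv ℝ u q (octBasis j b) • star (Octonion.e b))
      (∑ b, ((ContinuousLinearMap.apply ℝ ℝ (octBasis j b)).comp
        (fderiv ℝ (fderiv ℝ u) p)).smulRight (star (Octonion.e b))) p :=
    HasFDerivAt.fun_sum fun b _ =>
      ((ContinuousLinearMap.apply ℝ ℝ (octBasis j b)).hasFDerivAt.comp p hd2).smul_const _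
  rw [octHess, Matrix.of_apply, octDBar, h1.fderiv_eq, h2.fderiv]
  refine Finset.sum_congr rfl fun a _ => ?_
  simp only [sum_apply, ContinuousLinearMap.smulRight_apply, Finset.mul_sum, Octonion.mul_smul']
  rfl

/-- The octonionic Hessian is the octonionic Hermitian matrix of the second derivative. -/
theorem octHess_eq_octHermForm {u : OctPlane → ℝ} {p : OctPlane} (hu : ContDiffAt ℝ 2 u p) :
    (octHess u p 0 0).re = (octHermForm (fderiv ℝ (fderiv ℝ u) p)).1 ∧
    (octHess u p 1 1).re = (octHermForm (fderiv ℝ (fderiv ℝ u) p)).2.1 ∧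
    octHess u p 0 1 = (octHermForm (fderiv ℝ (fderiv ℝ u) p)).2.2 := by
  refine ⟨?_, ?_, ?_⟩
  · rw [octHess_apply hu, Octonion.re_sum_sum]; rfl
  · rw [octHess_apply hu, Octonion.re_sum_sum]; rfl
  · rw [octHess_apply hu]; rfl

/-- The determinant in the coordinates of `OctHerm`. -/
def OctHerm.det (X : OctHerm) : ℝ := X.1 * X.2.1 - ‖X.2.2‖ ^ 2

theorem octDet_toMatrix_add_octHess (X : OctHerm) {u : OctPlane → ℝ} {p : OctPlane}
    (hu : ContDiffAt ℝ 2 u p) :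
    octDet (X.toMatrix + octHess u p) = (X + octHermForm (fderiv ℝ (fderiv ℝ u) p)).det := by
  obtain ⟨h1, h2, h3⟩ := octHess_eq_octHermForm hu
  obtain ⟨k1, k2, k3⟩ := X.toMatrix_entries
  simp only [octDet, Matrix.add_apply, Octonion.re_add, h1, h2, h3, k1, k2, k3, OctHerm.det,
    Prod.fst_add, Prod.snd_add]

theorem octDet_toMatrix (X : OctHerm) : octDet X.toMatrix = X.det := by
  obtain ⟨k1, k2, k3⟩ := X.toMatrix_entries
  simp only [octDet, k1, k2, k3, OctHerm.det]

end Hessian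

/-! ### Positive matrices and the linearized determinant -/

theorem OctHerm.PosDef.fst_pos {X : OctHerm} (hX : X.PosDef) : 0 < X.1 := by
  have h := hX ![Octonion.e 0, 0] (fun h => by
    have := congrFun (congrArg (fun v => WithLp.ofLp v) (congrFun h 0)) 0
    simp [Octonion.e] at this)
  have : octQuad X.toMatrix ![Octonion.e 0, 0] = X.1 := by
    simp [octQuad, dotProduct, Matrix.mulVec, Fin.sum_univ_two, OctHerm.toMatrix, Octonion.ofReal,
      Octonion.re, Octonion.mul_def, Octonion.star_def, Octonion.e]
  rwa [this] at h

theorem OctHerm.PosDef.det_pos {X : OctHerm} (hX : X.PosDef) : 0 < X.det := by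
  have ha := hX.fst_pos
  obtain ⟨a, b, q⟩ := X
  simp only at ha
  -- at `(-q, a)` the quadratic form takes the value `a * det X`
  have h := hX ![-q, a • Octonion.e 0] (fun h => by
    have := congrFun (congrArg (fun v => WithLp.ofLp v) (congrFun h 1)) 0
    simp [Octonion.e, ha.ne'] at this)
  have : octQuad (OctHerm.toMatrix (a, b, q)) ![-q, a • Octonion.e 0] = a * (a * b - ‖q‖ ^ 2) := by
    simp [octQuad, dotProduct, Matrix.mulVec, Fin.sum_univ_two, OctHerm.toMatrix,
      Octonion.ofReal, EuclideanSpace.norm_sq_eq, Fin.sum_univ_eight,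
      Octonion.re, Octonion.mul_def, Octonion.star_def, Octonion.e]
    ring
  rw [this] at h
  exact (mul_pos_iff_of_pos_left ha).1 h

/-- For positive definite `X`, sixteen directions that diagonalize the linear second order operator
whose symbol is the adjugate of `X`; see `sum_octEllipticDir`. They come from completing the square
in the second octonionic variable. -/
def octEllipticDir (X : OctHerm) : Fin 8 ⊕ Fin 8 → OctPlane
  | .inl c => √X.1 • octBasis 1 c - (√X.1)⁻¹ • (Pi.single 0 (X.2.2 * Octonion.e c) : OctPlane)
  | .inr c => √(X.det / X.1) • octBasis 0 c

theorem octPlane_single_eq_sum (q : Octonion) :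
    (Pi.single 0 q : OctPlane) = ∑ a, q a • octBasis 0 a := by
  rw [octPlane_eq_sum (Pi.single 0 q)]
  simp

/-- The linearized determinant at `X`, applied to the octonionic Hermitian matrix of `S`, is the sum
of the values of `S` on the directions `octEllipticDir X`. -/
theorem sum_octEllipticDir {X : OctHerm} (ha : 0 < X.1) (hX : 0 ≤ X.det)
    {S : OctPlane →L[ℝ] OctPlane →L[ℝ] ℝ} (hS : ∀ v w, S v w = S w v) :
    ∑ k, S (octEllipticDir X k) (octEllipticDir X k) =
      X.1 * (octHermForm S).2.1 + X.2.1 * (octHermForm S).1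
        - 2 * inner ℝ X.2.2 (octHermForm S).2.2 := by
  obtain ⟨a, b, q⟩ := X
  simp only at ha
  have hs : √a * √a = a := Real.mul_self_sqrt ha.le
  have hsi : (√a)⁻¹ * (√a)⁻¹ = a⁻¹ := by rw [← mul_inv, hs]
  have hs0 : √a ≠ 0 := (Real.sqrt_pos.2 ha).ne'
  set D := OctHerm.det (a, b, q) with hD
  have hD' : D = a * b - ‖q‖ ^ 2 := rfl
  have hsd : √(D / a) * √(D / a) = D / a := Real.mul_self_sqrt (by positivity)
  have h1 : ∑ c, S (Pi.single 0 (q * Octonion.e c)) (octBasis 1 c) =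
      inner ℝ q (octHermForm S).2.2 := by
    rw [octHermForm_snd_snd, Octonion.sum_smul_mul_star]
    refine Finset.sum_congr rfl fun c _ => ?_
    simp [octPlane_single_eq_sum, map_sum]
  have h2 : ∑ c, S (Pi.single 0 (q * Octonion.e c)) (Pi.single 0 (q * Octonion.e c)) =
      ‖q‖ ^ 2 * (octHermForm S).1 := by
    have h : ∀ c, S (Pi.single 0 (q * Octonion.e c)) (Pi.single 0 (q * Octonion.e c)) =
        ∑ a, ∑ b, ((q * Octonion.e c) a * (q * Octonion.e c) b) *
          S (octBasis 0 a) (octBasis 0 b) := fun c => by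
      simp only [octPlane_single_eq_sum, map_sum, map_smul, sum_apply, smul_apply, smul_eq_mul,
        Finset.mul_sum]
      rw [Finset.sum_comm]
      exact Finset.sum_congr rfl fun a _ => Finset.sum_congr rfl fun b _ => by ring
    simp_rw [h]
    rw [Finset.sum_comm, octHermForm_fst, Finset.mul_sum]
    refine Finset.sum_congr rfl fun a _ => ?_
    rw [Finset.sum_comm]
    simp_rw [← Finset.sum_mul, Octonion.sum_mul_e_mul_e]
    simp
  have hl : ∀ c, S (octEllipticDir (a, b, q) (.inl c)) (octEllipticDir (a, b, q) (.inl c)) =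
      a * S (octBasis 1 c) (octBasis 1 c) - 2 * S (Pi.single 0 (q * Octonion.e c)) (octBasis 1 c)
        + a⁻¹ * S (Pi.single 0 (q * Octonion.e c)) (Pi.single 0 (q * Octonion.e c)) := by
    intro c
    simp only [octEllipticDir, map_sub, map_smul, sub_apply, smul_apply, smul_eq_mul,
      hS (octBasis 1 c) (Pi.single 0 _)]
    linear_combination S (octBasis 1 c) (octBasis 1 c) * hs
      - 2 * S (Pi.single 0 (q * Octonion.e c)) (octBasis 1 c) * mul_inv_cancel₀ hs0
      + S (Pi.single 0 (q * Octonion.e c)) (Pi.single 0 (q * Octonion.e c)) * hsi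
  have hr : ∀ c, S (octEllipticDir (a, b, q) (.inr c)) (octEllipticDir (a, b, q) (.inr c)) =
      D / a * S (octBasis 0 c) (octBasis 0 c) := by
    intro c
    simp only [octEllipticDir, map_smul, smul_apply, smul_eq_mul, ← mul_assoc]
    rw [hsd]
  rw [Fintype.sum_sum_type]
  simp only [hl, hr, Finset.sum_add_distrib, Finset.sum_sub_distrib, ← Finset.mul_sum, h1, h2]
  rw [← octHermForm_fst, ← octHermForm_snd_fst, hD']
  field_simp
  ring

/-- The directions `octEllipticDir X` span, that is, the operator is elliptic. -/
theorem eq_zero_of_apply_octEllipticDir {X : OctHerm} (ha : 0 < X.1) (hX : 0 < X.det)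
    {ℓ : OctPlane →L[ℝ] ℝ} (hℓ : ∀ k, ℓ (octEllipticDir X k) = 0) : ℓ = 0 := by
  have h0 : ∀ c, ℓ (octBasis 0 c) = 0 := fun c => by
    have h := hℓ (.inr c)
    rw [octEllipticDir, map_smul, smul_eq_mul, mul_eq_zero] at h
    exact h.resolve_left (Real.sqrt_pos.2 (div_pos hX ha)).ne'
  have h1 : ∀ c, ℓ (octBasis 1 c) = 0 := fun c => by
    have h := hℓ (.inl c)
    rw [octEllipticDir, map_sub, map_smul, map_smul, octPlane_single_eq_sum, map_sum] at h
    simp only [map_smul, h0, smul_eq_mul, mul_zero, Finset.sum_const_zero, sub_zero,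
      mul_eq_zero] at h
    exact h.resolve_left (Real.sqrt_pos.2 ha).ne'
  ext ξ
  rw [octPlane_eq_sum ξ]
  simp [Fin.sum_univ_two, h0, h1, map_sum]

theorem continuousOn_octEllipticDir {α : Type*} [TopologicalSpace α] {X : α → OctHerm} {s : Set α}
    (hX : ContinuousOn X s) (ha : ∀ x ∈ s, 0 < (X x).1) (k : Fin 8 ⊕ Fin 8) :
    ContinuousOn (fun x => octEllipticDir (X x) k) s := by
  have h1 : ContinuousOn (fun x => √(X x).1) s := Real.continuous_sqrt.comp_continuousOn hX.fst
  rcases k with c | c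
  · have hmul : Continuous fun q : Octonion => (Pi.single 0 (q * Octonion.e c) : OctPlane) := by
      let L : Octonion →ₗ[ℝ] OctPlane :=
        { toFun := fun q => Pi.single 0 (q * Octonion.e c)
          map_add' := fun x y => by rw [add_mul, Pi.single_add]
          map_smul' := fun r x => by rw [Octonion.smul_mul', Pi.single_smul]; rfl }
      exact L.continuous_of_finiteDimensional
    refine ContinuousOn.sub (h1.smul continuousOn_const) (ContinuousOn.smul (h1.inv₀ fun x hx =>
      (Real.sqrt_pos.2 (ha x hx)).ne') (hmul.comp_continuousOn hX.snd.snd))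
  · have hdet : ContinuousOn (fun x => (X x).det) s :=
      (hX.fst.mul hX.snd.fst).sub (hX.snd.snd.norm.pow 2)
    have h2 : ContinuousOn (fun x => √((X x).det / (X x).1)) s :=
      Real.continuous_sqrt.comp_continuousOn (hdet.div hX.fst fun x hx => (ha x hx).ne')
    exact h2.smul continuousOn_const

/-- The determinant is quadratic, so its difference at `X` and `Y` is its polarization at `X + Y`
and `X - Y`, without a remainder. -/
theorem OctHerm.det_sub_det (X Y : OctHerm) : 2 * (X.det - Y.det) =
    (X + Y).1 * (X - Y).2.1 + (X + Y).2.1 * (X - Y).1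
      - 2 * inner ℝ (X + Y).2.2 (X - Y).2.2 := by
  have : inner ℝ (X.2.2 + Y.2.2) (X.2.2 - Y.2.2) = ‖X.2.2‖ ^ 2 - ‖Y.2.2‖ ^ 2 := by
    rw [inner_add_left, inner_sub_right, inner_sub_right, real_inner_self_eq_norm_sq,
      real_inner_self_eq_norm_sq, real_inner_comm X.2.2 Y.2.2]
    ring
  simp only [Prod.fst_add, Prod.snd_add, Prod.fst_sub, Prod.snd_sub, this, OctHerm.det]
  ring

theorem OctHerm.fst_ne_zero_of_det_pos {X : OctHerm} (h : 0 < X.det) : X.1 ≠ 0 := by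
  intro h0
  simp only [OctHerm.det, h0, zero_mul, zero_sub] at h
  linarith [sq_nonneg ‖X.2.2‖]

theorem OctHerm.det_add_pos {X Y : OctHerm} (hX : 0 < X.1) (hX' : 0 < X.det) (hY : 0 < Y.1)
    (hY' : 0 < Y.det) : 0 < (X + Y).det := by
  obtain ⟨a, b, q⟩ := X
  obtain ⟨a', b', q'⟩ := Y
  simp only [OctHerm.det, Prod.mk_add_mk] at *
  have hq : ‖q + q'‖ ^ 2 ≤ (‖q‖ + ‖q'‖) ^ 2 := by gcongr; exact norm_add_le _ _
  -- `2 ‖q‖ ‖q'‖ ≤ a b' + a' b`, by comparing squares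
  have hb : 0 < b := by
    by_contra! h
    nlinarith [mul_nonneg hX.le (neg_nonneg.2 h), sq_nonneg ‖q‖]
  have hb' : 0 < b' := by
    by_contra! h
    nlinarith [mul_nonneg hY.le (neg_nonneg.2 h), sq_nonneg ‖q'‖]
  have h1 : (‖q‖ * ‖q'‖) ^ 2 ≤ (a * b) * (a' * b') := by
    rw [mul_pow]
    exact mul_le_mul (by linarith) (by linarith) (sq_nonneg _) (by positivity)
  have h2 : 2 * (‖q‖ * ‖q'‖) ≤ a * b' + a' * b := by
    refine le_of_sq_le_sq ?_ (by positivity)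
    nlinarith [sq_nonneg (a * b' - a' * b)]
  nlinarith

/-! ### Hessians on `GL₂(𝕆)`-manifolds -/

open Topology in
theorem affineGroupoid_le_contDiffGroupoid (G : Subgroup (OctPlane →L[ℝ] OctPlane)ˣ) :
    affineGroupoid G ≤ contDiffGroupoid 2 𝓘(ℝ, OctPlane) := by
  have key : ∀ (f : OctPlane → OctPlane) (s : Set OctPlane),
      (∀ x ∈ s, ∃ g ∈ G, ∃ c : OctPlane, ∀ᶠ y in 𝓝 x, f y = (g : OctPlane →L[ℝ] OctPlane) y + c) →
      ContDiffOn ℝ 2 f s := by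
    intro f s h x hx
    obtain ⟨g, _, c, hg⟩ := h x hx
    have : ContDiffAt ℝ 2 (fun y => (g : OctPlane →L[ℝ] OctPlane) y + c) x :=
      ((g : OctPlane →L[ℝ] OctPlane).contDiff.add contDiff_const).contDiffAt
    exact (this.congr_of_eventuallyEq hg).contDiffWithinAt
  intro e he
  have he' := mem_groupoid_of_pregroupoid.1 (show e ∈ Pregroupoid.groupoid _ from he)
  refine mem_groupoid_of_pregroupoid.2 ?_
  simp only [contDiffPregroupoid, modelWithCornersSelf_coe, modelWithCornersSelf_coe_symm,
    Function.id_comp, Function.comp_id, Set.preimage_id, Set.range_id, Set.inter_univ]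
  exact ⟨key _ _ he'.1, key _ _ he'.2⟩

section Manifold

open Filter Topology

variable {M : Type*} [TopologicalSpace M] [ChartedSpace OctPlane M]

theorem isManifold_of_hasGroupoid_affineGroupoid (G : Subgroup (OctPlane →L[ℝ] OctPlane)ˣ)
    [HasGroupoid M (affineGroupoid G)] : IsManifold 𝓘(ℝ, OctPlane) 2 M where
  toHasGroupoid := hasGroupoid_of_le ‹_› (affineGroupoid_le_contDiffGroupoid G)

theorem contDiffOn_comp_chart_symm [HasGroupoid M (affineGroupoid GL2Oct)] {φ : M → ℝ}
    (hφ : ContMDiff 𝓘(ℝ, OctPlane) 𝓘(ℝ, ℝ) 2 φ) {e : OpenPartialHomeomorph M OctPlane}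
    (he : e ∈ atlas OctPlane M) : ContDiffOn ℝ 2 (φ ∘ e.symm) e.target := by
  have : IsManifold 𝓘(ℝ, OctPlane) 2 M := isManifold_of_hasGroupoid_affineGroupoid GL2Oct
  rw [← contMDiffOn_iff_contDiffOn]
  exact hφ.comp_contMDiffOn
    (contMDiffOn_symm_of_mem_maximalAtlas (IsManifold.subset_maximalAtlas he))

theorem contDiffAt_comp_chart_symm [HasGroupoid M (affineGroupoid GL2Oct)] {φ : M → ℝ}
    (hφ : ContMDiff 𝓘(ℝ, OctPlane) 𝓘(ℝ, ℝ) 2 φ) {e : OpenPartialHomeomorph M OctPlane}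
    (he : e ∈ atlas OctPlane M) {x : M} (hx : x ∈ e.source) :
    ContDiffAt ℝ 2 (φ ∘ e.symm) (e x) :=
  (contDiffOn_comp_chart_symm hφ he).contDiffAt (e.open_target.mem_nhds (e.map_source hx))

theorem exists_eventually_chart_eq_affine [HasGroupoid M (affineGroupoid GL2Oct)]
    {e e' : OpenPartialHomeomorph M OctPlane} (he : e ∈ atlas OctPlane M)
    (he' : e' ∈ atlas OctPlane M) {x : M} (hx : x ∈ e.source ∩ e'.source) :
    ∃ (g : OctPlane →L[ℝ] OctPlane) (c : OctPlane),
      ∀ᶠ y in 𝓝 (e x), e' (e.symm y) = g y + c := by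
  have h := HasGroupoid.compatible (G := affineGroupoid GL2Oct) he he'
  rw [affineGroupoid, mem_groupoid_of_pregroupoid] at h
  obtain ⟨g, -, c, hg⟩ := h.1 (e x) (by simp [hx.1, hx.2])
  exact ⟨g, c, hg⟩

namespace OctHermSection

/-- The expression of `G + Hess φ` in a chart, in the coordinates of `OctHerm`. -/
def addHess (G : OctHermSection M) (φ : M → ℝ) (e : OpenPartialHomeomorph M OctPlane) (x : M) :
    OctHerm :=
  G.inChart e x + octHermForm (fderiv ℝ (fderiv ℝ (φ ∘ e.symm)) (e x))

/-- `G + Hess φ` transforms between charts by `ρ`, as `G` does. -/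
theorem exists_addHess_eq [HasGroupoid M (affineGroupoid GL2Oct)] (G : OctHermSection M)
    {φ : M → ℝ} (hφ : ContMDiff 𝓘(ℝ, OctPlane) 𝓘(ℝ, ℝ) 2 φ)
    {e e' : OpenPartialHomeomorph M OctPlane} (he : e ∈ atlas OctPlane M)
    (he' : e' ∈ atlas OctPlane M) {x : M} (hx : x ∈ e.source ∩ e'.source) :
    ∃ p ∈ octRhoGraph, G.addHess φ e' x = (p.2 : OctHerm →L[ℝ] OctHerm) (G.addHess φ e x) := by
  obtain ⟨g, c, hg⟩ := exists_eventually_chart_eq_affine he he' hx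
  obtain ⟨p, hp, hp1, hp2⟩ := G.transition e he e' he' x hx
  have hd : fderiv ℝ (e' ∘ e.symm) (e x) = g := by
    have h : (e' ∘ e.symm) =ᶠ[𝓝 (e x)] fun y => g y + c := hg
    rw [h.fderiv_eq]
    exact (g.hasFDerivAt.add_const c).fderiv
  have hgx : g (e x) + c = e' x := by
    rw [← hg.self_of_nhds, e.left_inv hx.1]
  have hu : ContDiffAt ℝ 2 (φ ∘ e'.symm) (g (e x) + c) := by
    rw [hgx]; exact contDiffAt_comp_chart_symm hφ he' hx.2
  have huv : (φ ∘ e.symm) =ᶠ[𝓝 (e x)] fun y => (φ ∘ e'.symm) (g y + c) := by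
    have hs : ∀ᶠ y in 𝓝 (e x), e.symm y ∈ e'.source :=
      (e.continuousAt_symm (e.map_source hx.1)).eventually
        (e'.open_source.mem_nhds (by rw [e.left_inv hx.1]; exact hx.2))
    filter_upwards [hg, hs] with y hy hys
    rw [← hy, Function.comp_apply, Function.comp_apply, e'.left_inv hys]
  have hS := fderiv_fderiv_eq_of_eventuallyEq_affine hu huv
  refine ⟨p, hp, ?_⟩
  have h2 := octHermForm_comp_of_mem hp (fun v w => hu.fderiv_fderiv_symm v w)
  rw [hp1, hd, ← hS, hgx] at h2
  rw [addHess, addHess, map_add, h2, hp2]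

theorem continuousOn_addHess [HasGroupoid M (affineGroupoid GL2Oct)] {G : OctHermSection M}
    (hG : G.IsContinuous) {φ : M → ℝ} (hφ : ContMDiff 𝓘(ℝ, OctPlane) 𝓘(ℝ, ℝ) 2 φ)
    {e : OpenPartialHomeomorph M OctPlane} (he : e ∈ atlas OctPlane M) :
    ContinuousOn (G.addHess φ e) e.source := by
  have h1 : ContinuousOn (fderiv ℝ (fderiv ℝ (φ ∘ e.symm))) e.target :=
    ((contDiffOn_comp_chart_symm hφ he).fderiv_of_isOpen e.open_target
      one_add_one_eq_two.le).continuousOn_fderiv_of_isOpen e.open_target le_rfl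
  exact (hG e he).add (continuous_octHermForm.comp_continuousOn (h1.comp e.continuousOn e.mapsTo))

theorem SolvesMongeAmpere.det_addHess [HasGroupoid M (affineGroupoid GL2Oct)]
    {G : OctHermSection M} {f φ : M → ℝ} (h : G.SolvesMongeAmpere f φ)
    (hφ : ContMDiff 𝓘(ℝ, OctPlane) 𝓘(ℝ, ℝ) 2 φ)
    {e : OpenPartialHomeomorph M OctPlane} (he : e ∈ atlas OctPlane M) {x : M}
    (hx : x ∈ e.source) : (G.addHess φ e x).det = Real.exp (f x) * (G.inChart e x).det := by
  rw [addHess, ← octDet_toMatrix_add_octHess _ (contDiffAt_comp_chart_symm hφ he hx),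
    h e he x hx, octDet_toMatrix]

theorem SolvesMongeAmpere.det_addHess_pos [HasGroupoid M (affineGroupoid GL2Oct)]
    {G : OctHermSection M} (hG : G.IsPositive) {f φ : M → ℝ} (h : G.SolvesMongeAmpere f φ)
    (hφ : ContMDiff 𝓘(ℝ, OctPlane) 𝓘(ℝ, ℝ) 2 φ)
    {e : OpenPartialHomeomorph M OctPlane} (he : e ∈ atlas OctPlane M) {x : M}
    (hx : x ∈ e.source) : 0 < (G.addHess φ e x).det := by
  rw [h.det_addHess hφ he hx]
  exact mul_pos (Real.exp_pos _) (hG e he x hx).det_pos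

/-- For a solution of the Monge-Ampère equation, `G + Hess φ` is positive definite everywhere: it is
so at a minimum of `φ`, and the set of such points is open and closed because the determinant has no
zeros. Where the determinant is positive, positive definiteness amounts to a positive corner
entry. -/
theorem SolvesMongeAmpere.addHess_fst_pos [CompactSpace M] [ConnectedSpace M]
    [HasGroupoid M (affineGroupoid GL2Oct)]
    {G : OctHermSection M} (hG : G.IsPositive) (hGc : G.IsContinuous) {f φ : M → ℝ}
    (h : G.SolvesMongeAmpere f φ) (hφ : ContMDiff 𝓘(ℝ, OctPlane) 𝓘(ℝ, ℝ) 2 φ)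
    {e : OpenPartialHomeomorph M OctPlane} (he : e ∈ atlas OctPlane M) {x : M}
    (hx : x ∈ e.source) : 0 < (G.addHess φ e x).1 := by
  have hdet : ∀ e ∈ atlas OctPlane M, ∀ x ∈ e.source, 0 < (G.addHess φ e x).det :=
    fun e he x hx => h.det_addHess_pos hG hφ he hx
  set P : Set M := {x | ∀ e ∈ atlas OctPlane M, x ∈ e.source → 0 < (G.addHess φ e x).1} with hP
  have hcont : ∀ e ∈ atlas OctPlane M, ContinuousOn (fun x => (G.addHess φ e x).1) e.source :=
    fun e he => (continuousOn_addHess hGc hφ he).fst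
  -- positivity in one chart is positivity in every chart
  have hone : ∀ e ∈ atlas OctPlane M, ∀ x ∈ e.source, 0 < (G.addHess φ e x).1 → x ∈ P := by
    intro e he x hx hpos e' he' hx'
    obtain ⟨p, hp, hpe⟩ := G.exists_addHess_eq hφ he he' ⟨hx, hx'⟩
    refine lt_of_le_of_ne ?_ (OctHerm.fst_ne_zero_of_det_pos (hdet e' he' x hx')).symm
    rw [hpe]
    exact fst_nonneg_of_mem hp hpos (hdet e he x hx).le
  have hopen : IsOpen P := by
    refine isOpen_iff_mem_nhds.2 fun x hx => ?_
    have he := chart_mem_atlas OctPlane x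
    have hxs := mem_chart_source OctPlane x
    have hnhds := (chartAt OctPlane x).open_source.mem_nhds hxs
    filter_upwards [hnhds, ((hcont _ he).continuousAt hnhds).eventually
      (lt_mem_nhds (hx _ he hxs))] with y hy hpos using hone _ he y hy hpos
  have hclosed : IsClosed P := by
    refine ⟨isOpen_iff_mem_nhds.2 fun x hx => ?_⟩
    have he := chart_mem_atlas OctPlane x
    have hxs := mem_chart_source OctPlane x
    have hnhds := (chartAt OctPlane x).open_source.mem_nhds hxs
    have hneg : (G.addHess φ (chartAt OctPlane x) x).1 < 0 :=
      lt_of_le_of_ne (not_lt.1 fun hpos => hx (hone _ he x hxs hpos))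
        (OctHerm.fst_ne_zero_of_det_pos (hdet _ he x hxs))
    filter_upwards [hnhds, ((hcont _ he).continuousAt hnhds).eventually
      (gt_mem_nhds hneg)] with y hy hlt hyP using (hyP _ he hy).not_gt hlt
  obtain ⟨x₀, -, hx₀⟩ := isCompact_univ.exists_isMinOn Set.univ_nonempty
    hφ.continuous.continuousOn
  have hx₀P : x₀ ∈ P := by
    intro e he hx
    have hu := contDiffAt_comp_chart_symm hφ he hx
    have hmin : IsLocalMin (φ ∘ e.symm) (e x₀) := Eventually.of_forall fun y => by
      rw [Function.comp_apply, Function.comp_apply, e.left_inv hx]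
      exact hx₀ (Set.mem_univ _)
    refine add_pos_of_pos_of_nonneg (hG e he x₀ hx).fst_pos ?_
    rw [octHermForm_fst]
    exact Finset.sum_nonneg fun a _ => hu.fderiv_fderiv_nonneg hmin _
  have huniv : P = Set.univ := IsClopen.eq_univ ⟨hclosed, hopen⟩ ⟨x₀, hx₀P⟩
  exact (huniv ▸ Set.mem_univ x : x ∈ P) e he hx

end OctHermSection

end Manifold

end

open Filter Topology in
theorem theoremT {M : Type*} [TopologicalSpace M] [T2Space M] [CompactSpace M] [ConnectedSpace M]
    [ChartedSpace OctPlane M] [HasGroupoid M (affineGroupoid GL2Oct)]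
    (G₀ : OctHermSection M) (hG₀ : G₀.IsContinuous) (hG₀_pos : G₀.IsPositive)
    (f : M → ℝ) (hf : Continuous f)
    (φ₁ φ₂ : M → ℝ) (hφ₁ : ContMDiff 𝓘(ℝ, OctPlane) 𝓘(ℝ, ℝ) 2 φ₁)
    (hφ₂ : ContMDiff 𝓘(ℝ, OctPlane) 𝓘(ℝ, ℝ) 2 φ₂)
    (h₁ : G₀.SolvesMongeAmpere f φ₁) (h₂ : G₀.SolvesMongeAmpere f φ₂) :
    ∃ c : ℝ, ∀ x, φ₁ x - φ₂ x = c := by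
  have hc : Continuous fun x => φ₁ x - φ₂ x := hφ₁.continuous.sub hφ₂.continuous
  obtain ⟨x₀, -, hx₀⟩ := isCompact_univ.exists_isMaxOn Set.univ_nonempty hc.continuousOn
  set m := φ₁ x₀ - φ₂ x₀ with hm
  refine ⟨m, fun x => ?_⟩
  have hclosed : IsClosed {x | φ₁ x - φ₂ x = m} := isClosed_eq hc continuous_const
  have hopen : IsOpen {x | φ₁ x - φ₂ x = m} := by
    refine isOpen_iff_mem_nhds.2 fun x hx => ?_
    set e := chartAt OctPlane x
    have he : e ∈ atlas OctPlane M := chart_mem_atlas OctPlane x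
    have hxs : x ∈ e.source := mem_chart_source OctPlane x
    -- the coefficients of the linear equation satisfied by `φ₁ - φ₂`
    set X : OctPlane → OctHerm := fun p =>
      G₀.addHess φ₁ e (e.symm p) + G₀.addHess φ₂ e (e.symm p) with hX
    have hXc : ContinuousOn X e.target :=
      ((OctHermSection.continuousOn_addHess hG₀ hφ₁ he).comp e.continuousOn_symm
        e.mapsTo_symm).add ((OctHermSection.continuousOn_addHess hG₀ hφ₂ he).comp
          e.continuousOn_symm e.mapsTo_symm)
    have hpos₁ : ∀ p ∈ e.target, 0 < (G₀.addHess φ₁ e (e.symm p)).1 := fun p hp =>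
      h₁.addHess_fst_pos hG₀_pos hG₀ hφ₁ he (e.map_target hp)
    have hpos₂ : ∀ p ∈ e.target, 0 < (G₀.addHess φ₂ e (e.symm p)).1 := fun p hp =>
      h₂.addHess_fst_pos hG₀_pos hG₀ hφ₂ he (e.map_target hp)
    have hXpos : ∀ p ∈ e.target, 0 < (X p).1 := fun p hp => add_pos (hpos₁ p hp) (hpos₂ p hp)
    have hXdet : ∀ p ∈ e.target, 0 < (X p).det := fun p hp =>
      OctHerm.det_add_pos (hpos₁ p hp) (h₁.det_addHess_pos hG₀_pos hφ₁ he (e.map_target hp))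
        (hpos₂ p hp) (h₂.det_addHess_pos hG₀_pos hφ₂ he (e.map_target hp))
    have hu₁ := contDiffOn_comp_chart_symm hφ₁ he
    have hu₂ := contDiffOn_comp_chart_symm hφ₂ he
    have key := eventually_eq_of_sum_fderiv_fderiv_nonneg e.open_target
      (w := fun p => (φ₁ ∘ e.symm) p - (φ₂ ∘ e.symm) p) (hu₁.sub hu₂)
      (ξ := fun k p => octEllipticDir (X p) k)
      (fun k => continuousOn_octEllipticDir hXc hXpos k)
      (fun p hp ℓ hℓ => eq_zero_of_apply_octEllipticDir (hXpos p hp) (hXdet p hp) hℓ)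
      ?_ (m := m) (fun p _ => hx₀ (Set.mem_univ (e.symm p))) (e.map_source hxs)
      (by simpa [e.left_inv hxs] using hx)
    · filter_upwards [(e.continuousAt hxs).eventually key, e.open_source.mem_nhds hxs] with y hy hys
      simpa [e.left_inv hys] using hy
    · intro p hp
      have hn := e.open_target.mem_nhds hp
      have hw₁ := hu₁.contDiffAt hn
      have hw₂ := hu₂.contDiffAt hn
      rw [hw₁.fderiv_fderiv_sub hw₂]
      rw [sum_octEllipticDir (hXpos p hp) (hXdet p hp).le (fun v w => by
        rw [sub_apply, sub_apply, sub_apply, sub_apply, hw₁.fderiv_fderiv_symm v w,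
          hw₂.fderiv_fderiv_symm v w])]
      have hdiff : octHermForm (fderiv ℝ (fderiv ℝ (φ₁ ∘ e.symm)) p -
          fderiv ℝ (fderiv ℝ (φ₂ ∘ e.symm)) p) =
          G₀.addHess φ₁ e (e.symm p) - G₀.addHess φ₂ e (e.symm p) := by
        rw [OctHermSection.addHess, OctHermSection.addHess, e.right_inv hp, octHermForm_sub]
        abel
      rw [hdiff, ← OctHerm.det_sub_det, h₁.det_addHess hφ₁ he (e.map_target hp),
        h₂.det_addHess hφ₂ he (e.map_target hp), sub_self, mul_zero]
  have huniv := IsClopen.eq_univ ⟨hclosed, hopen⟩ ⟨x₀, hm.symm⟩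
  exact huniv.symm.subset (Set.mem_univ x)
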